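/- Consider episodic non-stationary Markov decision processes (MDPs) with $S$ states, $A$ actions and $M$ episodes of $H$ steps each, $T = MH$ steps in total. At step $h$ of episode $m$, taking action $a$ in state $s$ yields a random reward in $[0,1]$ with mean $r_h^m(s,a)$, and the next state is drawn from $P_h^m(\cdot\mid s,a)$. The initial states $s_1^1,\dots,s_1^M$ of the episodes are fixed in advance and belong to the instance (oblivious adversary). The variation of the MDP is $$\Delta=\sum_{m=1}^{M-1}\sum_{h=1}^{H}\sup_{s,a}\bigl|r_h^m(s,a)-r_h^{m+1}(s,a)\bigr|+\sum_{m=1}^{M-1}\sum_{h=1}^{H}\sup_{s,a}\bigl\|P_h^m(\cdot\mid s,a)-P_h^{m+1}(\cdot\mid s,a)\bigr\|_1 .$$ A learning algorithm is any (possibly randomized) rule that chooses each action from the current state and all states, actions and rewards observed so far, over all episodes. Its dynamic regret is $$\mathcal R=\sum_{m=1}^{M}\Bigl(V_1^{m,\star}(s_1^m)-\mathbb E\Bigl[\sum_{h=1}^{H} r_h^m(s_h^m,a_h^m)\Bigr]\Bigr),$$ where $V_1^{m,\star}(s)$ is the supremum over deterministic policies of the expected total reward in episode $m$ started from state $s$,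 and the expectation is over the interaction of the algorithm with the MDP. Theorem. There are universal constants $c, C>0$ such that for all integers $S,A,H,M\ge 2$ and all real $\Delta>0$ with $T=MH\ge C\,SA\Delta H^2$, the following holds. For every learning algorithm there is an episodic non-stationary MDP with $S$ states, $A$ actions and $M$ episodes of length $H$, with variation exactly $\Delta$ and with rewards that do not change over time (only the transition kernels vary), on which the dynamic regret of the algorithm is at least $$c\, S^{1/3}A^{1/3}\Delta^{1/3}H^{2/3}T^{2/3}.$$ -/

import Mathlib

/-- An episodic non-stationary Markov decision process with state space `S` and action space `A`.
Episodes and the steps inside an episode are numbered from `0`: for `M` episodes of length `H` the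
time index `(m, h)` runs over `m < M`, `h < H`, and no notion below looks at the data at any other
index. `initState m` is the initial state of episode `m`; it is fixed in advance (oblivious
adversary). -/
structure NonstationaryMDP (S A : Type) where
  /-- the transition kernels: `trans m h s a` is the law of the next state -/
  trans : ℕ → ℕ → S → A → PMF S
  /-- the law of the random reward, a number in `[0, 1]` -/
  rewardLaw : ℕ → ℕ → S → A → PMF unitInterval
  /-- the initial state of each episode -/
  initState : ℕ → S

/-- What is seen in one step: state, action, realized reward, next state. -/
abbrev Observation (S A : Type) : Type := S × A × unitInterval × S

/-- A (possibly randomized) learning algorithm: given everything seen so far (over all episodes,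
most recent step first) and the current state, it chooses a law from which the next action
is drawn. -/
def LearningAlgorithm (S A : Type) : Type := List (Observation S A) → S → PMF A

namespace NonstationaryMDP

variable {S A : Type}

/-- The mean reward `r_h^m(s, a)`. -/
noncomputable def meanReward (E : NonstationaryMDP S A) (m h : ℕ) (s : S) (a : A) : ℝ :=
  ∑' x : unitInterval, (E.rewardLaw m h s a x).toReal * (x : ℝ)

/-- The law of the state at step `h + k` of episode `m`, when the state at step `h` is `s` and the
deterministic policy `π` (indexed by episode, step and state) is followed. -/
noncomputable def stateLaw (E : NonstationaryMDP S A) (π : ℕ → ℕ → S → A) (m h : ℕ) (s : S) :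
    ℕ → PMF S
  | 0 => PMF.pure s
  | k + 1 => (stateLaw E π m h s k).bind fun x => E.trans m (h + k) x (π m (h + k) x)

/-- The value function `V_h^{m,π}(s)`: the expected total mean reward collected in the steps
`h, …, H - 1` of episode `m` when `π` is followed from state `s` at step `h`. -/
noncomputable def value [Fintype S] (E : NonstationaryMDP S A) (H : ℕ) (π : ℕ → ℕ → S → A)
    (m h : ℕ) (s : S) : ℝ :=
  ∑ k ∈ Finset.range (H - h), ∑ x : S,
    (E.stateLaw π m h s k x).toReal * E.meanReward m (h + k) x (π m (h + k) x)

/-- The optimal value function `V_h^{m,⋆}(s) = sup_π V_h^{m,π}(s)`. -/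
noncomputable def optimalValue [Fintype S] (E : NonstationaryMDP S A) (H m h : ℕ) (s : S) : ℝ :=
  ⨆ π : ℕ → ℕ → S → A, E.value H π m h s

/-- The joint law of the observations made in the first `n` steps (over all episodes of length `H`)
and of the state in which step `n` starts, when `alg` interacts with the process. Step `n` is step
`n % H` of episode `n / H`; at the end of an episode the state is reset to the initial state of the
next one. -/
noncomputable def interaction (E : NonstationaryMDP S A) (H : ℕ) (alg : LearningAlgorithm S A) :
    ℕ → PMF (List (Observation S A) × S)
  | 0 => PMF.pure ([], E.initState 0)
  | n + 1 =>
    (interaction E H alg n).bind fun z =>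
      (alg z.1 z.2).bind fun a =>
        (E.rewardLaw (n / H) (n % H) z.2 a).bind fun R =>
          (E.trans (n / H) (n % H) z.2 a).bind fun s' =>
            PMF.pure ((z.2, a, R, s') :: z.1,
              if (n + 1) % H = 0 then E.initState ((n + 1) / H) else s')

/-- The law of the state-action pair of step `n` (over all episodes) under `alg`. -/
noncomputable def stateActionLaw (E : NonstationaryMDP S A) (H : ℕ) (alg : LearningAlgorithm S A)
    (n : ℕ) : PMF (S × A) :=
  (E.interaction H alg n).bind fun z => (alg z.1 z.2).map fun a => (z.2, a)

/-- The expected total reward of `alg` in episode `m`. -/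
noncomputable def algorithmValue [Fintype S] [Fintype A] (E : NonstationaryMDP S A) (H : ℕ)
    (alg : LearningAlgorithm S A) (m : ℕ) : ℝ :=
  ∑ h ∈ Finset.range H, ∑ p : S × A,
    (E.stateActionLaw H alg (m * H + h) p).toReal * E.meanReward m h p.1 p.2

/-- The (expected) dynamic regret of `alg` over `M` episodes of length `H`. -/
noncomputable def dynamicRegret [Fintype S] [Fintype A] (E : NonstationaryMDP S A) (M H : ℕ)
    (alg : LearningAlgorithm S A) : ℝ :=
  ∑ m ∈ Finset.range M, (E.optimalValue H m 0 (E.initState m) - E.algorithmValue H alg m)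

/-- The variation `Δ_r` of the mean rewards. -/
noncomputable def rewardVariation (E : NonstationaryMDP S A) (M H : ℕ) : ℝ :=
  ∑ m ∈ Finset.range (M - 1), ∑ h ∈ Finset.range H,
    ⨆ p : S × A, |E.meanReward m h p.1 p.2 - E.meanReward (m + 1) h p.1 p.2|

/-- The variation `Δ_p` of the transition kernels, in `L¹`-norm. -/
noncomputable def transitionVariation [Fintype S] (E : NonstationaryMDP S A) (M H : ℕ) : ℝ :=
  ∑ m ∈ Finset.range (M - 1), ∑ h ∈ Finset.range H,
    ⨆ p : S × A, ∑ s' : S,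
      |(E.trans m h p.1 p.2 s').toReal - (E.trans (m + 1) h p.1 p.2 s').toReal|

/-- The total variation `Δ = Δ_r + Δ_p`. -/
noncomputable def variation [Fintype S] (E : NonstationaryMDP S A) (M H : ℕ) : ℝ :=
  E.rewardVariation M H + E.transitionVariation M H

end NonstationaryMDP

open Finset
open scoped ENNReal

/-! The hard instance pays reward `1` in an absorbing goal and `0` elsewhere; from any other state
each action climbs to the goal at rate about `δ = 1/(8H)` and otherwise stays put. Episodes start in
the `S - 1` other states in turn and are grouped into blocks of `L`. In even blocks every place
(block, step, state) hides one action with rate `δ + ε`; in odd blocks there is none.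

A learner that plays a wrong action in the first half of an episode delays the goal, and each such
shortfall `ε` costs of order `H` rewards: `ε * H ^ 2` per episode (`climbMDP.le_episodeRegret`). To
find the hidden action the learner must try the `A` actions at that place, but a block offers only
about `L/S` visits, each yielding information of order `ε ^ 2 / δ`. Information is measured by the
loss of the affinity `∑ PQ/(P+Q)` between the interaction laws with and without the hidden action
(`climbMDP.half_le_affinity_add`, `climbMDP.playProb_le_reference`). Averaging over all tables of
hidden actions yields one bad table (`climbMDP.exists_le_dynamicRegret`).

Each change of block costs variation about `2 * ε * H`, so the budget `Δ` fixes `L`, of order `ε * H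
* M / Δ`; the information bound then fixes `ε`. The transition in the last step of an episode
influences no reward, so its rate is varied freely to bring the variation to exactly `Δ`
(`climbMDP.variation_eq`). -/

/-- The real probabilities of a law on a finite type sum to one. -/
theorem PMF.sum_toReal {α : Type*} [Fintype α] (p : PMF α) : ∑ a, (p a).toReal = 1 := by
  rw [← ENNReal.toReal_sum fun a _ => p.apply_ne_top a, ← tsum_fintype (L := .unconditional α),
    p.tsum_coe, ENNReal.toReal_one]

theorem PMF.toReal_bind {α β : Type*} [Fintype α] (p : PMF α) (f : α → PMF β) (b : β) :
    (p.bind f b).toReal = ∑ a, (p a).toReal * (f a b).toReal := by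
  rw [PMF.bind_apply, tsum_fintype,
    ENNReal.toReal_sum fun a _ => ENNReal.mul_ne_top (p.apply_ne_top a) ((f a).apply_ne_top b)]
  simp

theorem PMF.toReal_le_one {α : Type*} (p : PMF α) (a : α) : (p a).toReal ≤ 1 :=
  ENNReal.toReal_mono ENNReal.one_ne_top (p.coe_le_one a)

theorem PMF.toReal_pure {α : Type*} [DecidableEq α] (a b : α) :
    (PMF.pure a b).toReal = if b = a then 1 else 0 := by
  rw [PMF.pure_apply]; split_ifs <;> simp

/-! ### Occupation probabilities under a learning algorithm. -/

namespace NonstationaryMDP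

variable {S A : Type}

/-- The law of the state in which step `n` starts. -/
noncomputable def visitLaw (E : NonstationaryMDP S A) (H : ℕ) (alg : LearningAlgorithm S A)
    (n : ℕ) : PMF S :=
  (E.interaction H alg n).map Prod.snd

/-- The real probability that step `n` starts in `x`. -/
noncomputable def visitProb (E : NonstationaryMDP S A) (H : ℕ) (alg : LearningAlgorithm S A)
    (n : ℕ) (x : S) : ℝ :=
  (E.visitLaw H alg n x).toReal

/-- The real probability that step `n` starts in `x` and that action `a` is chosen. -/
noncomputable def playProb (E : NonstationaryMDP S A) (H : ℕ) (alg : LearningAlgorithm S A)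
    (n : ℕ) (x : S) (a : A) : ℝ :=
  (E.stateActionLaw H alg n (x, a)).toReal

theorem visitProb_le_one (E : NonstationaryMDP S A) (H : ℕ) (alg : LearningAlgorithm S A)
    (n : ℕ) (x : S) : E.visitProb H alg n x ≤ 1 := PMF.toReal_le_one _ _

theorem playProb_nonneg (E : NonstationaryMDP S A) (H : ℕ) (alg : LearningAlgorithm S A)
    (n : ℕ) (x : S) (a : A) : 0 ≤ E.playProb H alg n x a := ENNReal.toReal_nonneg

theorem map_fst_stateActionLaw (E : NonstationaryMDP S A) (H : ℕ) (alg : LearningAlgorithm S A)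
    (n : ℕ) : (E.stateActionLaw H alg n).map Prod.fst = E.visitLaw H alg n := by
  simp only [stateActionLaw, visitLaw, PMF.map_bind, PMF.map_comp]
  simp only [Function.comp_def]
  conv_lhs => enter [2, z]; rw [show (fun _ : A => z.2) = Function.const A z.2 from rfl,
    PMF.map_const]
  rfl

theorem sum_playProb [Fintype S] [Fintype A] (E : NonstationaryMDP S A) (H : ℕ)
    (alg : LearningAlgorithm S A) (n : ℕ) (x : S) :
    ∑ a, E.playProb H alg n x a = E.visitProb H alg n x := by
  classical
  rw [visitProb, ← map_fst_stateActionLaw, PMF.map_apply, tsum_fintype, Fintype.sum_prod_type,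
    Finset.sum_comm, ENNReal.toReal_sum]
  · refine Finset.sum_congr rfl fun a _ => ?_
    rw [Finset.sum_eq_single x] <;> simp +contextual [playProb, eq_comm]
  · intro a _
    rw [Finset.sum_eq_single x (fun b _ hb => by simp [hb.symm]) (by simp)]
    simpa using PMF.apply_ne_top _ _

theorem visitLaw_succ (E : NonstationaryMDP S A) (H : ℕ) (alg : LearningAlgorithm S A)
    (n : ℕ) : E.visitLaw H alg (n + 1) = (E.stateActionLaw H alg n).bind fun p =>
      (E.trans (n / H) (n % H) p.1 p.2).map fun s' =>
        if (n + 1) % H = 0 then E.initState ((n + 1) / H) else s' := by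
  simp only [visitLaw, interaction, stateActionLaw, PMF.bind_bind, PMF.pure_bind,
    PMF.bind_const, Function.comp_def, PMF.map]

theorem visitProb_succ [Fintype S] [Fintype A] (E : NonstationaryMDP S A) {H : ℕ}
    (alg : LearningAlgorithm S A) {m h : ℕ} (hh : h + 1 < H) (x : S) :
    E.visitProb H alg (m * H + (h + 1)) x =
      ∑ p : S × A, E.playProb H alg (m * H + h) p.1 p.2 * (E.trans m h p.1 p.2 x).toReal := by
  have h1 : (m * H + h) / H = m := by
    rw [mul_comm, Nat.mul_add_div (by omega), Nat.div_eq_of_lt (by omega), add_zero]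
  have h2 : (m * H + h) % H = h := by
    rw [Nat.mul_add_mod', Nat.mod_eq_of_lt (by omega)]
  have h3 : (m * H + h + 1) % H ≠ 0 := by
    rw [add_assoc, Nat.mul_add_mod', Nat.mod_eq_of_lt (by omega)]; omega
  rw [visitProb, ← add_assoc, visitLaw_succ, h1, h2]
  simp only [h3, if_false]
  rw [PMF.toReal_bind]
  refine Finset.sum_congr rfl fun p _ => ?_
  rw [show (fun s' : S => s') = id from rfl, PMF.map_id]
  rfl

theorem visitProb_start [DecidableEq S] (E : NonstationaryMDP S A) {H : ℕ} (hH : 0 < H)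
    (alg : LearningAlgorithm S A) (m : ℕ) (x : S) :
    E.visitProb H alg (m * H) x = if x = E.initState m then 1 else 0 := by
  rcases Nat.eq_zero_or_pos m with rfl | hm
  · rw [zero_mul, visitProb, visitLaw, interaction, PMF.pure_map, PMF.toReal_pure]
  · obtain ⟨n, hn⟩ : ∃ n, m * H = n + 1 := ⟨m * H - 1, by have := Nat.mul_pos hm hH; omega⟩
    have : E.visitLaw H alg (m * H) = PMF.pure (E.initState m) := by
      rw [hn, visitLaw_succ, ← hn]
      simp only [Nat.mul_mod_left, if_true, Nat.mul_div_cancel _ hH]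
      conv_lhs => enter [2, z]; rw [show (fun _ : S => E.initState m) =
        Function.const S (E.initState m) from rfl, PMF.map_const]
      exact PMF.bind_const _ _
    rw [visitProb, this, PMF.toReal_pure]

end NonstationaryMDP

/-! ### The climbing process and the regret of one episode. -/

/-- From `x`, move to `g` with probability `ρ` and stay otherwise. -/
noncomputable def climbLaw {S : Type} [Fintype S] [DecidableEq S] (g x : S) (ρ : unitInterval) :
    PMF S :=
  PMF.ofFintype
    (fun y => ENNReal.ofReal ((if y = g then (ρ : ℝ) else 0) + if y = x then 1 - (ρ : ℝ) else 0))
    (by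
      have := ρ.2.1
      have := ρ.2.2
      rw [← ENNReal.ofReal_sum_of_nonneg, Finset.sum_add_distrib]
      · simp
      · intro y _; split_ifs <;> linarith)

theorem climbLaw_toReal {S : Type} [Fintype S] [DecidableEq S] (g x : S) (ρ : unitInterval)
    (y : S) : (climbLaw g x ρ y).toReal =
      (if y = g then (ρ : ℝ) else 0) + if y = x then 1 - (ρ : ℝ) else 0 := by
  have := ρ.2.1
  have := ρ.2.2
  rw [climbLaw, PMF.ofFintype_apply, ENNReal.toReal_ofReal]
  split_ifs <;> linarith

/-- The process in which the only reward is collected in the absorbing state `g`, and in which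
action `a` in state `x` leads to `g` with probability `ρ m h x a` and else leaves the state
unchanged. -/
noncomputable def climbMDP {S A : Type} [Fintype S] [DecidableEq S] (g : S) (init : ℕ → S)
    (ρ : ℕ → ℕ → S → A → unitInterval) : NonstationaryMDP S A where
  trans m h x a := climbLaw g x (ρ m h x a)
  rewardLaw _ _ x _ := PMF.pure (if x = g then 1 else 0)
  initState := init

namespace climbMDP

open NonstationaryMDP

variable {S A : Type} [Fintype S] [DecidableEq S] (g : S) (init : ℕ → S)
  (ρ : ℕ → ℕ → S → A → unitInterval)

theorem meanReward_eq (m h : ℕ) (x : S) (a : A) :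
    (climbMDP g init ρ).meanReward m h x a = if x = g then 1 else 0 := by
  rw [NonstationaryMDP.meanReward, tsum_eq_single (if x = g then 1 else 0 : unitInterval)]
  · simp only [climbMDP, PMF.pure_apply_self]
    split_ifs <;> simp
  · intro b hb
    simp [climbMDP, PMF.pure_apply_of_ne _ _ hb]

theorem visitProb_succ_of_ne [Fintype A] {H : ℕ} (alg : LearningAlgorithm S A) {m h : ℕ}
    (hh : h + 1 < H) {x : S} (hx : x ≠ g) :
    (climbMDP g init ρ).visitProb H alg (m * H + (h + 1)) x =
      ∑ a, (climbMDP g init ρ).playProb H alg (m * H + h) x a * (1 - ρ m h x a) := by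
  rw [visitProb_succ _ _ hh, Fintype.sum_prod_type, Finset.sum_eq_single x]
  · refine Finset.sum_congr rfl fun a _ => ?_
    congr 1
    change (climbLaw g x (ρ m h x a) x).toReal = _
    simp [climbLaw_toReal, hx]
  · intro y _ hy
    refine Finset.sum_eq_zero fun a _ => ?_
    rw [show (climbMDP g init ρ).trans m h y a = climbLaw g y (ρ m h y a) from rfl]
    simp [climbLaw_toReal, hx, hy.symm]
  · simp

/-- A state other than the goal and the initial state is never visited. -/
theorem visitProb_eq_zero [Fintype A] {H : ℕ} (alg : LearningAlgorithm S A) {m h : ℕ}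
    (hh : h < H) {x : S} (hx : x ≠ g) (hi : x ≠ init m) :
    (climbMDP g init ρ).visitProb H alg (m * H + h) x = 0 := by
  induction h with
  | zero =>
    rw [add_zero, visitProb_start _ (by omega)]
    exact if_neg hi
  | succ h ih =>
    rw [visitProb_succ_of_ne _ _ _ _ hh hx]
    refine Finset.sum_eq_zero fun a _ => ?_
    have h1 := ih (by omega)
    rw [← sum_playProb, Finset.sum_eq_zero_iff_of_nonneg fun a _ => playProb_nonneg _ _ _ _ _ _]
      at h1
    rw [h1 a (Finset.mem_univ a), zero_mul]

theorem value_le (H : ℕ) (π : ℕ → ℕ → S → A) (m h : ℕ) (x : S) :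
    (climbMDP g init ρ).value H π m h x ≤ ∑ _k ∈ Finset.range (H - h), ∑ _x : S, (1 : ℝ) := by
  refine Finset.sum_le_sum fun k _ => Finset.sum_le_sum fun y _ => ?_
  rw [meanReward_eq]
  have := PMF.toReal_le_one ((climbMDP g init ρ).stateLaw π m h x k) y
  have h0 : 0 ≤ ((climbMDP g init ρ).stateLaw π m h x k y).toReal := ENNReal.toReal_nonneg
  split_ifs <;> linarith

/-- Following a policy that moves to the goal at rate `r` collects what a geometric waiting time
allows. -/
theorem le_optimalValue {H m : ℕ} {r : ℝ} (hm : init m ≠ g) (θ : ℕ → S → A)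
    (hθ : ∀ h x, h + 1 < H → x ≠ g → (ρ m h x (θ h x) : ℝ) = r) :
    ∑ h ∈ Finset.range H, (1 - (1 - r) ^ h) ≤
      (climbMDP g init ρ).optimalValue H m 0 (init m) := by
  have hb : BddAbove (Set.range fun π : ℕ → ℕ → S → A =>
      (climbMDP g init ρ).value H π m 0 (init m)) :=
    ⟨_, by rintro _ ⟨π, rfl⟩; exact value_le g init ρ H π m 0 (init m)⟩
  refine le_trans (le_of_eq ?_) (le_ciSup hb fun _ h x => θ h x)
  rw [NonstationaryMDP.value, Nat.sub_zero]
  refine Finset.sum_congr rfl fun k hk => ?_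
  replace hk := Finset.mem_range.1 hk
  simp only [meanReward_eq, mul_ite, mul_one, mul_zero, Finset.sum_ite_eq', Finset.mem_univ,
    if_true]
  clear hb
  induction k with
  | zero => simp [NonstationaryMDP.stateLaw, PMF.pure_apply, hm.symm]
  | succ k ih =>
    have ih := ih (by omega)
    rw [NonstationaryMDP.stateLaw, PMF.toReal_bind]
    have h1 : ∀ x : S, ((climbMDP g init ρ).trans m (0 + k) x (θ (0 + k) x) g).toReal =
        r + if x = g then 1 - r else 0 := by
      intro x
      change (climbLaw g x (ρ m (0 + k) x (θ (0 + k) x)) g).toReal = _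
      rw [climbLaw_toReal]
      by_cases hx : x = g
      · simp [hx]
      · rw [hθ _ _ (by omega) hx]
        simp [hx, Ne.symm hx]
    simp only [h1, mul_add, Finset.sum_add_distrib, ← Finset.sum_mul, PMF.sum_toReal, mul_ite,
      mul_zero, Finset.sum_ite_eq', Finset.mem_univ, if_true]
    rw [← ih]
    ring

theorem algorithmValue_le [Fintype A] {H m : ℕ} (alg : LearningAlgorithm S A)
    (hm : init m ≠ g) : (climbMDP g init ρ).algorithmValue H alg m ≤
      ∑ h ∈ Finset.range H, (1 - (climbMDP g init ρ).visitProb H alg (m * H + h) (init m)) := by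
  rw [NonstationaryMDP.algorithmValue]
  refine Finset.sum_le_sum fun h _ => ?_
  simp only [meanReward_eq, mul_ite, mul_one, mul_zero, Fintype.sum_prod_type]
  rw [Finset.sum_eq_single g (fun y _ hy => by simp [hy]) (by simp)]
  simp only [if_true]
  rw [show ∑ a, ((climbMDP g init ρ).stateActionLaw H alg (m * H + h) (g, a)).toReal =
    (climbMDP g init ρ).visitProb H alg (m * H + h) g from sum_playProb _ _ _ _ _]
  have h1 := PMF.sum_toReal ((climbMDP g init ρ).visitLaw H alg (m * H + h))
  have h2 := Finset.sum_le_sum_of_subset_of_nonneg (Finset.subset_univ ({g, init m} : Finset S))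
    (f := fun x => ((climbMDP g init ρ).visitLaw H alg (m * H + h) x).toReal)
    (fun _ _ _ => ENNReal.toReal_nonneg)
  rw [Finset.sum_pair hm.symm, h1] at h2
  unfold visitProb
  linarith

/-- The regret of one episode is bounded below by the expected shortfall of the rates of the
actions played in the first half of the episode. -/
theorem le_episodeRegret [Fintype A] {H m : ℕ} {r : ℝ} (hr0 : 0 ≤ r) (hr1 : r ≤ 1)
    (alg : LearningAlgorithm S A) (hm : init m ≠ g) (θ : ℕ → S → A)
    (hθ : ∀ h x, h + 1 < H → x ≠ g → (ρ m h x (θ h x) : ℝ) = r)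
    (hρ : ∀ h x a, h + 1 < H → x ≠ g → (ρ m h x a : ℝ) ≤ r) :
    (1 - r) ^ H * ((H / 2 : ℝ) * ∑ k ∈ Finset.range (H / 2), ∑ a,
      (climbMDP g init ρ).playProb H alg (m * H + k) (init m) a * (r - ρ m k (init m) a)) ≤
    (climbMDP g init ρ).optimalValue H m 0 (init m) -
      (climbMDP g init ρ).algorithmValue H alg m := by
  have h1 := le_optimalValue g init ρ hm θ hθ
  have h2 := algorithmValue_le g init ρ (H := H) alg hm
  set q : ℕ → ℝ := fun h => (climbMDP g init ρ).visitProb H alg (m * H + h) (init m) with hq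
  set w : ℕ → ℝ := fun k => ∑ a, (climbMDP g init ρ).playProb H alg (m * H + k) (init m) a *
    (r - ρ m k (init m) a) with hw
  have hw0 : ∀ k, k + 1 < H → 0 ≤ w k := fun k hk => Finset.sum_nonneg fun a _ =>
    mul_nonneg (playProb_nonneg _ _ _ _ _ _) (by linarith [hρ k (init m) a hk hm])
  -- An ideal player keeps mass `(1 - r) ^ h` outside the goal; `w h` is the extra mass left behind
  -- at step `h`.
  have hrec : ∀ h, h + 1 < H → q (h + 1) = (1 - r) * q h + w h := by
    intro h hh
    simp only [hq, hw]
    rw [visitProb_succ_of_ne _ _ _ _ hh hm, ← sum_playProb, Finset.mul_sum,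
      ← Finset.sum_add_distrib]
    exact Finset.sum_congr rfl fun a _ => by ring
  -- Extra mass decays at most at rate `r` per step, so all of it is still present at time `h` up to
  -- the factor `(1 - r) ^ h`.
  have hd : ∀ h, h < H → (1 - r) ^ h * ∑ k ∈ Finset.range h, w k ≤ q h - (1 - r) ^ h := by
    intro h
    induction h with
    | zero =>
      intro hh
      simp only [hq, add_zero]
      rw [visitProb_start _ hh]
      simp [climbMDP]
    | succ h ih =>
      intro hh
      have ih := mul_le_mul_of_nonneg_left (ih (by omega)) (sub_nonneg.2 hr1)
      have hp : (1 - r) ^ (h + 1) * w h ≤ w h :=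
        mul_le_of_le_one_left (hw0 h hh) (pow_le_one₀ (by linarith) (by linarith))
      rw [hrec h hh, Finset.sum_range_succ]
      rw [pow_succ] at hp ⊢
      nlinarith
  have hW0 : ∀ n, n < H → 0 ≤ ∑ k ∈ Finset.range n, w k := fun n hn =>
    Finset.sum_nonneg fun k hk => hw0 k (by have := Finset.mem_range.1 hk; omega)
  have hpow : 0 ≤ (1 - r) ^ H := pow_nonneg (by linarith) _
  -- Each shortfall from the first half is charged at every step of the second half, which gives the
  -- factor `H / 2`.
  have hd' : ∀ h ∈ Finset.range H,
      (1 - r) ^ H * (if H / 2 ≤ h then ∑ k ∈ Finset.range (H / 2), w k else 0) ≤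
        q h - (1 - r) ^ h := by
    intro h hh
    have hh := Finset.mem_range.1 hh
    refine le_trans ?_ (hd h hh)
    refine mul_le_mul (pow_le_pow_of_le_one (by linarith) (by linarith) hh.le) ?_ ?_
      (pow_nonneg (by linarith) _)
    · split_ifs with hle
      · refine Finset.sum_le_sum_of_subset_of_nonneg (by simpa using hle) fun k hk _ => ?_
        exact hw0 k (by have := Finset.mem_range.1 hk; omega)
      · exact hW0 h hh
    · split_ifs with hle
      · exact hW0 _ (by omega)
      · rfl
  have hsum := Finset.sum_le_sum hd'
  rw [← Finset.mul_sum, ← Finset.sum_filter, Finset.sum_const, nsmul_eq_mul] at hsum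
  have hcard : (H / 2 : ℝ) ≤ ((Finset.range H).filter fun h => H / 2 ≤ h).card := by
    have : (Finset.range H).filter (fun h => H / 2 ≤ h) = Finset.Ico (H / 2) H := by
      ext h; simp [and_comm]
    rw [this, Nat.card_Ico, Nat.cast_sub (by omega)]
    have : ((H / 2 : ℕ) : ℝ) ≤ (H : ℝ) / 2 := Nat.cast_div_le
    linarith
  have hWn : 0 ≤ ∑ k ∈ Finset.range (H / 2), w k := by
    rcases Nat.eq_zero_or_pos H with rfl | h0
    · simp
    · exact hW0 _ (by omega)
  have hfin := mul_le_mul_of_nonneg_left (mul_le_mul_of_nonneg_right hcard hWn) hpow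
  refine hfin.trans (hsum.trans ?_)
  have e1 : ∑ h ∈ Finset.range H, (q h - (1 - r) ^ h) =
      ∑ h ∈ Finset.range H, (1 - (1 - r) ^ h) - ∑ h ∈ Finset.range H, (1 - q h) := by
    rw [← Finset.sum_sub_distrib]
    exact Finset.sum_congr rfl fun h _ => by ring
  rw [e1]
  linarith

/-- As long as the rates are at most `r`, the initial state is left at most at rate `r`. -/
theorem le_visitProb [Fintype A] {H m : ℕ} {r : ℝ} (hr1 : r ≤ 1)
    (alg : LearningAlgorithm S A) (hm : init m ≠ g)
    (hρ : ∀ h x a, h + 1 < H → x ≠ g → (ρ m h x a : ℝ) ≤ r) {h : ℕ} (hh : h < H) :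
    (1 - r) ^ h ≤ (climbMDP g init ρ).visitProb H alg (m * H + h) (init m) := by
  induction h with
  | zero => rw [add_zero, visitProb_start _ (by omega)]; simp [climbMDP]
  | succ h ih =>
    rw [visitProb_succ_of_ne _ _ _ _ hh hm]
    have ih := mul_le_mul_of_nonneg_right (ih (by omega)) (sub_nonneg.2 hr1)
    rw [← sum_playProb, Finset.sum_mul] at ih
    rw [pow_succ]
    refine ih.trans (Finset.sum_le_sum fun a _ => mul_le_mul_of_nonneg_left ?_
      (playProb_nonneg _ _ _ _ _ _))
    linarith [hρ h (init m) a hh hm]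

end climbMDP

/-! ### Harmonic affinity: scalar inequalities and change of measure. -/

/-- Second-order lower bound for the harmonic mean of `x * p` and `y * q` around `q = p`. -/
theorem harmonic_tangent_le {x y p q : ℝ} (hx : 0 ≤ x) (hy : 0 ≤ y) (hp : 0 < p)
    (hq : p / 2 ≤ q) :
    p * (x * y / (x + y)) + x * (q - p) * (x * y / (x + y) ^ 2) - x * ((q - p) ^ 2 / p) / 2 ≤
      (x * p) * (y * q) / (x * p + y * q) := by
  have hq0 : 0 < q := by linarith
  rcases hx.eq_or_lt with rfl | hx
  · simp
  have hs : 0 < x + y := by linarith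
  have hd : 0 < x * p + y * q := by positivity
  -- The remainder of the tangent at `q = p` has a closed form; only its last factor needs a bound.
  have key : (x * p) * (y * q) / (x * p + y * q) -
      (p * (x * y / (x + y)) + x * (q - p) * (x * y / (x + y) ^ 2)) =
      - (x * ((q - p) ^ 2 / p)) * (x * y ^ 2 * p / ((x + y) ^ 2 * (x * p + y * q))) := by
    field_simp
    ring
  have hb : x * y ^ 2 * p / ((x + y) ^ 2 * (x * p + y * q)) ≤ 1 / 2 := by
    rw [div_le_div_iff₀ (by positivity) (by norm_num)]
    have h1 : (x + y) * (p / 2) ≤ x * p + y * q := by nlinarith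
    have h2 : (x + y) ^ 2 * ((x + y) * (p / 2)) ≤ (x + y) ^ 2 * (x * p + y * q) :=
      mul_le_mul_of_nonneg_left h1 (by positivity)
    have h3 : 4 * (x * y ^ 2) ≤ (x + y) ^ 3 := by
      nlinarith [mul_nonneg hx.le (sq_nonneg (x - y)), pow_nonneg hx.le 3, pow_nonneg hy 3,
        mul_nonneg hy (sq_nonneg (x - y)), mul_nonneg (mul_nonneg hx.le hx.le) hy]
    nlinarith
  have hv : 0 ≤ x * ((q - p) ^ 2 / p) := by positivity
  have := mul_le_mul_of_nonneg_left hb hv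
  linarith

/-- Tangents at `δ` and `1 - δ` with opposite increments `ε` and `-ε`: the linear terms cancel. The
error carries the weight `x` alone, so information will be counted under the reference law only. -/
theorem harmonic_two_point_le {x y δ ε : ℝ} (hx : 0 ≤ x) (hy : 0 ≤ y) (hδ : 0 < δ)
    (hδ2 : δ ≤ 1 / 4) (hε : 0 ≤ ε) (hεδ : ε ≤ δ) :
    x * y / (x + y) ≤ (x * δ) * (y * (δ + ε)) / (x * δ + y * (δ + ε)) +
      (x * (1 - δ)) * (y * (1 - (δ + ε))) / (x * (1 - δ) + y * (1 - (δ + ε))) +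
      x * (ε ^ 2 / δ) := by
  have h1 := harmonic_tangent_le (q := δ + ε) hx hy hδ (by linarith)
  have h2 := harmonic_tangent_le (p := 1 - δ) (q := 1 - (δ + ε)) hx hy (by linarith) (by linarith)
  have h3 : ε ^ 2 / (1 - δ) ≤ ε ^ 2 / δ :=
    div_le_div_of_nonneg_left (by positivity) hδ (by linarith)
  have h4 := mul_le_mul_of_nonneg_left h3 hx
  rw [show δ + ε - δ = ε by ring] at h1
  rw [show 1 - (δ + ε) - (1 - δ) = -ε by ring, neg_sq] at h2
  linarith

/-- With `s = x + y` and `d = y - x` one has `32 * x * y / s = 8 * s - 8 * d ^ 2 / s`, so the claim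
rests on `d ≤ 8 * d ^ 2 / s + s / 32`, which is AM-GM. The slack `1/32`, summed over two laws,
becomes the `1/16` of later bounds. -/
theorem le_add_of_harmonic {x y φ : ℝ} (hx : 0 ≤ x) (hy : 0 ≤ y) (h0 : 0 ≤ φ) (h1 : φ ≤ 1) :
    y * φ + 32 * (x * y / (x + y)) ≤ x * φ + (8 + 1 / 32) * (x + y) := by
  rcases (add_nonneg hx hy).eq_or_lt with h | hs
  · obtain rfl : x = 0 := by linarith
    obtain rfl : y = 0 := by linarith
    simp
  have hh : 32 * (x * y / (x + y)) + max (y - x) 0 ≤ (8 + 1 / 32) * (x + y) := by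
    rw [← mul_div_assoc, div_add' _ _ _ hs.ne', div_le_iff₀ hs]
    rcases max_cases (y - x) 0 with ⟨h, _⟩ | ⟨h, _⟩ <;> rw [h]
    · nlinarith [sq_nonneg ((x + y) - 16 * (y - x))]
    · nlinarith [sq_nonneg (x - y), mul_nonneg hs.le hs.le]
  have : (y - x) * φ ≤ max (y - x) 0 :=
    (mul_le_mul_of_nonneg_right (le_max_left _ _) h0).trans
      (mul_le_of_le_one_right (le_max_right _ _) h1)
  linarith

/-- Half the harmonic mean. -/
noncomputable def halfHarmonic (x y : ℝ≥0∞) : ℝ≥0∞ :=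
  ENNReal.ofReal (x.toReal * y.toReal / (x.toReal + y.toReal))

theorem mul_div_add_mono {x y x' y' : ℝ} (hx : 0 ≤ x) (hy : 0 ≤ y) (hxx : x ≤ x') (hyy : y ≤ y') :
    x * y / (x + y) ≤ x' * y' / (x' + y') := by
  rcases hx.eq_or_lt with rfl | hx
  · simp only [zero_mul, zero_div]
    exact div_nonneg (mul_nonneg hxx (hy.trans hyy)) (add_nonneg hxx (hy.trans hyy))
  rw [div_le_div_iff₀ (by linarith) (by linarith)]
  nlinarith [mul_nonneg (mul_nonneg hy (hy.trans hyy)) (sub_nonneg.2 hxx),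
    mul_nonneg (mul_nonneg hx.le (hx.le.trans hxx)) (sub_nonneg.2 hyy)]

theorem halfHarmonic_mono {x y x' y' : ℝ≥0∞} (hx : x ≤ x') (hy : y ≤ y') (hx' : x' ≠ ∞)
    (hy' : y' ≠ ∞) : halfHarmonic x y ≤ halfHarmonic x' y' :=
  ENNReal.ofReal_le_ofReal (mul_div_add_mono ENNReal.toReal_nonneg ENNReal.toReal_nonneg
    (ENNReal.toReal_mono hx' hx) (ENNReal.toReal_mono hy' hy))

/-- The harmonic affinity of two laws. -/
noncomputable def affinity {α : Type*} (P Q : PMF α) : ℝ≥0∞ := ∑' z, halfHarmonic (P z) (Q z)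

theorem affinity_self {α : Type*} (P : PMF α) : affinity P P = 2⁻¹ := by
  have : ∀ z, halfHarmonic (P z) (P z) = P z * 2⁻¹ := by
    intro z
    rw [halfHarmonic]
    have : (P z).toReal * (P z).toReal / ((P z).toReal + (P z).toReal) = (P z * 2⁻¹).toReal := by
      rw [ENNReal.toReal_mul, ENNReal.toReal_inv, ENNReal.toReal_ofNat]
      by_cases h : (P z).toReal = 0
      · simp [h]
      · field_simp; norm_num
    rw [this, ENNReal.ofReal_toReal
      (ENNReal.mul_ne_top (P.apply_ne_top z) (by simp))]
  rw [affinity, tsum_congr this, ENNReal.tsum_mul_right, P.tsum_coe, one_mul]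

theorem halfHarmonic_le_left (x y : ℝ≥0∞) : halfHarmonic x y ≤ x := by
  rw [halfHarmonic]
  refine ENNReal.ofReal_le_of_le_toReal ?_
  have h1 : 0 ≤ x.toReal := ENNReal.toReal_nonneg
  have h2 : 0 ≤ y.toReal := ENNReal.toReal_nonneg
  exact div_le_of_le_mul₀ (by positivity) h1 (by nlinarith)

theorem affinity_ne_top {α : Type*} (P Q : PMF α) : affinity P Q ≠ ∞ := by
  refine ne_top_of_le_ne_top ENNReal.one_ne_top ?_
  rw [← P.tsum_coe]
  exact ENNReal.tsum_le_tsum fun z => halfHarmonic_le_left _ _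

/-- Change of measure: expectations of functions with values in `[0, 1]` under laws of large
affinity are close. -/
theorem tsum_mul_add_affinity_le {α : Type*} (P Q : PMF α) (φ : α → ℝ≥0∞) (hφ : ∀ z, φ z ≤ 1) :
    ∑' z, Q z * φ z + 32 * affinity P Q ≤ ∑' z, P z * φ z + ENNReal.ofReal (16 + 1 / 16) := by
  have hpt : ∀ z, Q z * φ z + 32 * halfHarmonic (P z) (Q z) ≤
      P z * φ z + ENNReal.ofReal (8 + 1 / 32) * (P z + Q z) := by
    intro z
    have hφ' : φ z ≠ ∞ := ne_top_of_le_ne_top ENNReal.one_ne_top (hφ z)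
    have hP := P.apply_ne_top z
    have hQ := Q.apply_ne_top z
    have := le_add_of_harmonic (x := (P z).toReal) (y := (Q z).toReal) (φ := (φ z).toReal)
      ENNReal.toReal_nonneg ENNReal.toReal_nonneg ENNReal.toReal_nonneg
      (ENNReal.toReal_mono ENNReal.one_ne_top (hφ z))
    have hh : halfHarmonic (P z) (Q z) ≠ ∞ := ENNReal.ofReal_ne_top
    rw [← ENNReal.toReal_le_toReal (by finiteness) (by finiteness),
      ENNReal.toReal_add (by finiteness) (by finiteness),
      ENNReal.toReal_add (by finiteness) (by finiteness)]
    simp only [ENNReal.toReal_mul, ENNReal.toReal_add hP hQ, ENNReal.toReal_ofNat]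
    rw [halfHarmonic, ENNReal.toReal_ofReal (by positivity), ENNReal.toReal_ofReal (by norm_num)]
    exact this
  have := ENNReal.tsum_le_tsum hpt
  rw [ENNReal.tsum_add, ENNReal.tsum_add, ENNReal.tsum_mul_left, ENNReal.tsum_mul_left,
    ENNReal.tsum_add, P.tsum_coe, Q.tsum_coe] at this
  refine this.trans (le_of_eq ?_)
  congr 1
  rw [show (1 : ℝ≥0∞) + 1 = ENNReal.ofReal 2 by norm_num, ← ENNReal.ofReal_mul (by norm_num)]
  norm_num

/-! ### Loss of affinity along the interaction. -/

namespace climbMDP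

open NonstationaryMDP

variable {S A : Type}

theorem stateActionLaw_apply [Fintype A] [DecidableEq S] (E : NonstationaryMDP S A) (H : ℕ) (alg : LearningAlgorithm S A)
    (n : ℕ) (s : S) (a : A) : E.stateActionLaw H alg n (s, a) =
      ∑' z, E.interaction H alg n z * if z.2 = s then alg z.1 z.2 a else 0 := by
  rw [NonstationaryMDP.stateActionLaw, PMF.bind_apply]
  refine tsum_congr fun z => ?_
  congr 1
  rw [PMF.map_apply, tsum_fintype, Finset.sum_eq_single a]
  · simp [eq_comm]
  · intro b _ hb; simp [hb.symm]
  · simp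

/-- What is recorded after one more step. -/
noncomputable def extend [DecidableEq S] (g : S) (init : ℕ → S) (H n : ℕ)
    (w : (List (Observation S A) × S) × A × S) : List (Observation S A) × S :=
  ((w.1.2, w.2.1, if w.1.2 = g then 1 else 0, w.2.2) :: w.1.1,
    if (n + 1) % H = 0 then init ((n + 1) / H) else w.2.2)

theorem extend_injective [DecidableEq S] (g : S) (init : ℕ → S) (H n : ℕ) :
    Function.Injective (extend (A := A) g init H n) := by
  rintro ⟨⟨l, s⟩, a, s'⟩ ⟨⟨l2, s2⟩, a2, s2'⟩ h
  simp only [extend, Prod.mk.injEq, List.cons.injEq] at h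
  obtain ⟨⟨⟨rfl, rfl, _, rfl⟩, rfl⟩, _⟩ := h
  rfl

/-- A lower bound is enough: `halfHarmonic` is monotone and `extend` is injective, so it bounds the
next affinity from below. -/
theorem le_interaction_extend [Fintype S] [DecidableEq S] (g : S) (init : ℕ → S) (ρ : ℕ → ℕ → S → A → unitInterval) (H : ℕ)
    (alg : LearningAlgorithm S A) (n : ℕ) (w : (List (Observation S A) × S) × A × S) :
    (climbMDP g init ρ).interaction H alg n w.1 * (alg w.1.1 w.1.2 w.2.1 *
      climbLaw g w.1.2 (ρ (n / H) (n % H) w.1.2 w.2.1) w.2.2) ≤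
      (climbMDP g init ρ).interaction H alg (n + 1) (extend g init H n w) := by
  rw [NonstationaryMDP.interaction, PMF.bind_apply]
  refine le_trans ?_ (ENNReal.le_tsum w.1)
  gcongr
  rw [PMF.bind_apply]
  refine le_trans ?_ (ENNReal.le_tsum w.2.1)
  gcongr
  simp only [climbMDP]
  rw [PMF.pure_bind, PMF.bind_apply]
  refine le_trans ?_ (ENNReal.le_tsum w.2.2)
  simp [extend]

variable [Fintype S] [DecidableEq S] [Fintype A] [DecidableEq A]
  (g : S) (init : ℕ → S) (ρ₀ ρ₁ : ℕ → ℕ → S → A → unitInterval) {s : S} {a₀ : A}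
  {δ ε : ℝ} {B : ℕ → Prop} [DecidablePred B]

/-- `V` says that the two rates differ here. The algorithm's choice `α` is a common factor of both
masses and comes out; if the kernels agree, so do their probabilities, and nothing is lost. -/
theorem le_sum_harmonic_climbLaw {x y α : ℝ≥0∞} {t : S} {r₀ r₁ : unitInterval} {V : Prop}
    [Decidable V] (hδ : 0 < δ) (hδ2 : δ ≤ 1 / 4) (hε : 0 ≤ ε) (hεδ : ε ≤ δ)
    (hV : V → t ≠ g ∧ (r₀ : ℝ) = δ ∧ (r₁ : ℝ) = δ + ε) (hV' : ¬ V → r₀ = r₁) :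
    α.toReal * (x.toReal * y.toReal / (x.toReal + y.toReal)) ≤
      ∑ s', (x * (α * climbLaw g t r₀ s')).toReal * (y * (α * climbLaw g t r₁ s')).toReal /
        ((x * (α * climbLaw g t r₀ s')).toReal + (y * (α * climbLaw g t r₁ s')).toReal) +
      if V then x.toReal * α.toReal * (ε ^ 2 / δ) else 0 := by
  simp only [ENNReal.toReal_mul]
  generalize hX : x.toReal = X
  generalize hY : y.toReal = Y
  generalize hα : α.toReal = a
  have hX0 : 0 ≤ X := hX ▸ ENNReal.toReal_nonneg
  have hY0 : 0 ≤ Y := hY ▸ ENNReal.toReal_nonneg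
  have ha0 : 0 ≤ a := hα ▸ ENNReal.toReal_nonneg
  have hterm : ∀ u v : ℝ, X * (a * u) * (Y * (a * v)) / (X * (a * u) + Y * (a * v)) =
      a * ((X * u) * (Y * v) / (X * u + Y * v)) := by
    intro u v
    rcases ha0.eq_or_lt with rfl | ha
    · simp
    rw [show X * (a * u) * (Y * (a * v)) = a * (a * (X * u * (Y * v))) by ring,
      show X * (a * u) + Y * (a * v) = a * (X * u + Y * v) by ring,
      mul_div_mul_left _ _ ha.ne', mul_div_assoc]
  simp only [hterm]
  by_cases h : V
  · obtain ⟨htg, h0, h1⟩ := hV h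
    rw [if_pos h, ← Finset.mul_sum]
    have hsum := Finset.sum_le_sum_of_subset_of_nonneg (Finset.subset_univ ({g, t} : Finset S))
      (f := fun s' => X * (climbLaw g t r₀ s').toReal * (Y * (climbLaw g t r₁ s').toReal) /
        (X * (climbLaw g t r₀ s').toReal + Y * (climbLaw g t r₁ s').toReal))
      (fun _ _ _ => by positivity)
    rw [Finset.sum_pair htg.symm] at hsum
    simp only [climbLaw_toReal, h0, h1, htg, htg.symm, if_true, if_false, add_zero, zero_add]
      at hsum
    have h2 := mul_le_mul_of_nonneg_left
      ((harmonic_two_point_le hX0 hY0 hδ hδ2 hε hεδ).trans (add_le_add_left hsum _)) ha0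
    simp only [climbLaw_toReal, h0, h1]
    linarith
  · rw [hV' h, if_neg h, add_zero, ← Finset.mul_sum]
    refine mul_le_mul_of_nonneg_left (le_of_eq ?_) ha0
    have : ∀ u : ℝ, X * u * (Y * u) / (X * u + Y * u) = u * (X * Y / (X + Y)) := by
      intro u
      by_cases hu : u = 0
      · simp [hu]
      rw [show X * u * (Y * u) = u * (u * (X * Y)) by ring,
        show X * u + Y * u = u * (X + Y) by ring, mul_div_mul_left _ _ hu, mul_div_assoc]
    simp only [this]
    rw [← Finset.sum_mul, PMF.sum_toReal, one_mul]

/-- Only the play of `a₀` in `s` at a time in `B` separates the two processes, so one step costs `ε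
^ 2 / δ` times its probability under the reference. -/
theorem affinity_le_succ (hs : s ≠ g) (hδ : 0 < δ) (hδ2 : δ ≤ 1 / 4) (hε : 0 ≤ ε) (hεδ : ε ≤ δ)
    (alg : LearningAlgorithm S A) {H : ℕ} (n : ℕ)
    (hB : B n → (ρ₀ (n / H) (n % H) s a₀ : ℝ) = δ ∧ (ρ₁ (n / H) (n % H) s a₀ : ℝ) = δ + ε)
    (hB' : ∀ x a, ¬ (B n ∧ x = s ∧ a = a₀) → ρ₀ (n / H) (n % H) x a = ρ₁ (n / H) (n % H) x a) :
    affinity ((climbMDP g init ρ₀).interaction H alg n) ((climbMDP g init ρ₁).interaction H alg n) ≤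
    affinity ((climbMDP g init ρ₀).interaction H alg (n + 1))
        ((climbMDP g init ρ₁).interaction H alg (n + 1)) +
      if B n then ENNReal.ofReal (ε ^ 2 / δ) * (climbMDP g init ρ₀).stateActionLaw H alg n (s, a₀)
      else 0 := by
  set P := (climbMDP g init ρ₀).interaction H alg n with hP
  set Q := (climbMDP g init ρ₁).interaction H alg n with hQ
  have step1 : ∑' w : (List (Observation S A) × S) × A × S,
      halfHarmonic (P w.1 * (alg w.1.1 w.1.2 w.2.1 *
          climbLaw g w.1.2 (ρ₀ (n / H) (n % H) w.1.2 w.2.1) w.2.2))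
        (Q w.1 * (alg w.1.1 w.1.2 w.2.1 *
          climbLaw g w.1.2 (ρ₁ (n / H) (n % H) w.1.2 w.2.1) w.2.2)) ≤
      affinity ((climbMDP g init ρ₀).interaction H alg (n + 1))
        ((climbMDP g init ρ₁).interaction H alg (n + 1)) := by
    refine le_trans (ENNReal.tsum_le_tsum fun w => ?_)
      (ENNReal.tsum_comp_le_tsum_of_injective (extend_injective g init H n) _)
    exact halfHarmonic_mono (le_interaction_extend g init ρ₀ H alg n w)
      (le_interaction_extend g init ρ₁ H alg n w) (PMF.apply_ne_top _ _) (PMF.apply_ne_top _ _)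
  refine le_trans ?_ (add_le_add_left step1 _)
  have step2 : (if B n then ENNReal.ofReal (ε ^ 2 / δ) *
      (climbMDP g init ρ₀).stateActionLaw H alg n (s, a₀) else 0) =
      ∑' z, ∑ a, if B n ∧ z.2 = s ∧ a = a₀ then
        P z * alg z.1 z.2 a * ENNReal.ofReal (ε ^ 2 / δ) else 0 := by
    split_ifs with h
    · rw [stateActionLaw_apply, ← ENNReal.tsum_mul_left]
      refine tsum_congr fun z => ?_
      rw [Finset.sum_eq_single a₀ (fun b _ hb => by simp [hb]) (by simp)]
      by_cases hz : z.2 = s <;> (simp [h, hz]; try ring)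
    · simp [h]
  rw [step2, ENNReal.tsum_prod', ← ENNReal.tsum_add]
  refine ENNReal.tsum_le_tsum fun z => ?_
  rw [tsum_fintype, Fintype.sum_prod_type, ← Finset.sum_add_distrib]
  have hz : halfHarmonic (P z) (Q z) = ∑ a, ENNReal.ofReal ((alg z.1 z.2 a).toReal *
      ((P z).toReal * (Q z).toReal / ((P z).toReal + (Q z).toReal))) := by
    rw [← ENNReal.ofReal_sum_of_nonneg fun a _ => by positivity, ← Finset.sum_mul,
      PMF.sum_toReal, one_mul, halfHarmonic]
  rw [hz]
  refine Finset.sum_le_sum fun a _ => ?_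
  have key := le_sum_harmonic_climbLaw g (x := P z) (y := Q z) (α := alg z.1 z.2 a) (t := z.2)
    (r₀ := ρ₀ (n / H) (n % H) z.2 a) (r₁ := ρ₁ (n / H) (n % H) z.2 a)
    (V := B n ∧ z.2 = s ∧ a = a₀) hδ hδ2 hε hεδ
    (by rintro ⟨h1, h2, h3⟩; rw [h2, h3]; exact ⟨hs, hB h1⟩) (hB' _ _)
  refine (ENNReal.ofReal_le_ofReal key).trans ?_
  rw [ENNReal.ofReal_add (Finset.sum_nonneg fun s' _ => by positivity)
    (by split_ifs <;> positivity), ENNReal.ofReal_sum_of_nonneg fun s' _ => by positivity]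
  refine add_le_add le_rfl ?_
  split_ifs
  · rw [ENNReal.ofReal_mul (by positivity), ENNReal.ofReal_mul (by positivity),
      ENNReal.ofReal_toReal (PMF.apply_ne_top _ _), ENNReal.ofReal_toReal (PMF.apply_ne_top _ _)]
  · simp

theorem half_le_affinity_add (hs : s ≠ g) (hδ : 0 < δ) (hδ2 : δ ≤ 1 / 4) (hε : 0 ≤ ε)
    (hεδ : ε ≤ δ) (alg : LearningAlgorithm S A) {H : ℕ}
    (hB : ∀ n, B n →
      (ρ₀ (n / H) (n % H) s a₀ : ℝ) = δ ∧ (ρ₁ (n / H) (n % H) s a₀ : ℝ) = δ + ε)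
    (hB' : ∀ n x a, ¬ (B n ∧ x = s ∧ a = a₀) →
      ρ₀ (n / H) (n % H) x a = ρ₁ (n / H) (n % H) x a) (n : ℕ) :
    2⁻¹ ≤ affinity ((climbMDP g init ρ₀).interaction H alg n)
        ((climbMDP g init ρ₁).interaction H alg n) +
      ∑ i ∈ (Finset.range n).filter B,
        ENNReal.ofReal (ε ^ 2 / δ) * (climbMDP g init ρ₀).stateActionLaw H alg i (s, a₀) := by
  induction n with
  | zero =>
    rw [show (climbMDP g init ρ₀).interaction H alg 0 = (climbMDP g init ρ₁).interaction H alg 0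
      from rfl, affinity_self]
    simp
  | succ n ih =>
    refine ih.trans ((add_le_add_left (affinity_le_succ g init ρ₀ ρ₁ hs hδ hδ2 hε hεδ alg n
      (hB n) (hB' n)) _).trans (le_of_eq ?_))
    rw [Finset.sum_filter, Finset.sum_filter, Finset.sum_range_succ]
    ring

/-- The probability that the better action is played exceeds the one under the reference process
only a little, unless the action was tried often under the latter. -/
theorem playProb_le_reference (hs : s ≠ g) (hδ : 0 < δ) (hδ2 : δ ≤ 1 / 4) (hε : 0 ≤ ε)
    (hεδ : ε ≤ δ) (alg : LearningAlgorithm S A) {H : ℕ}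
    (hB : ∀ n, B n →
      (ρ₀ (n / H) (n % H) s a₀ : ℝ) = δ ∧ (ρ₁ (n / H) (n % H) s a₀ : ℝ) = δ + ε)
    (hB' : ∀ n x a, ¬ (B n ∧ x = s ∧ a = a₀) →
      ρ₀ (n / H) (n % H) x a = ρ₁ (n / H) (n % H) x a) (n : ℕ) :
    (climbMDP g init ρ₁).playProb H alg n s a₀ ≤ (climbMDP g init ρ₀).playProb H alg n s a₀ +
      1 / 16 + 32 * (ε ^ 2 / δ) *
        ∑ i ∈ (Finset.range n).filter B, (climbMDP g init ρ₀).playProb H alg i s a₀ := by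
  -- The affinity is `1/2` minus at most the information gathered; multiplied by `32`, this uses up
  -- the `16` in the change of measure and leaves `1/16`.
  have h1 := half_le_affinity_add g init ρ₀ ρ₁ hs hδ hδ2 hε hεδ alg hB hB' n
  have h2 := tsum_mul_add_affinity_le ((climbMDP g init ρ₀).interaction H alg n)
    ((climbMDP g init ρ₁).interaction H alg n)
    (fun z => if z.2 = s then alg z.1 z.2 a₀ else 0)
    (fun z => by
      split_ifs
      exacts [PMF.coe_le_one (alg z.1 z.2) _, zero_le_one])
  rw [← stateActionLaw_apply, ← stateActionLaw_apply] at h2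
  have hF := affinity_ne_top ((climbMDP g init ρ₀).interaction H alg n)
    ((climbMDP g init ρ₁).interaction H alg n)
  have hfin : ∀ i, (climbMDP g init ρ₀).stateActionLaw H alg i (s, a₀) ≠ ∞ :=
    fun i => PMF.apply_ne_top _ _
  have hfin' : (climbMDP g init ρ₁).stateActionLaw H alg n (s, a₀) ≠ ∞ := PMF.apply_ne_top _ _
  have hterm : ∀ i ∈ (Finset.range n).filter B,
      ENNReal.ofReal (ε ^ 2 / δ) * (climbMDP g init ρ₀).stateActionLaw H alg i (s, a₀) ≠ ∞ :=
    fun i _ => ENNReal.mul_ne_top ENNReal.ofReal_ne_top (hfin i)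
  have hsum := ENNReal.sum_ne_top.2 hterm
  rw [← ENNReal.toReal_le_toReal (by finiteness) (ENNReal.add_ne_top.2 ⟨hF, hsum⟩),
    ENNReal.toReal_add hF hsum, ENNReal.toReal_sum hterm] at h1
  have hfn := hfin n
  rw [← ENNReal.toReal_le_toReal (by finiteness) (by finiteness),
    ENNReal.toReal_add hfin' (by finiteness), ENNReal.toReal_add hfn (by finiteness),
    ENNReal.toReal_mul, ENNReal.toReal_ofReal (by norm_num)] at h2
  simp only [ENNReal.toReal_mul, ENNReal.toReal_ofReal (show (0 : ℝ) ≤ ε ^ 2 / δ by positivity),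
    ENNReal.toReal_inv, ENNReal.toReal_ofNat, ← Finset.mul_sum] at h1 h2
  unfold playProb
  linarith

end climbMDP

/-! ### Hidden tables of better actions and averaging over them. -/

/-- Resampling one coordinate does not change the sum over all functions. -/
theorem sum_sum_update {ι α : Type*} [Fintype ι] [DecidableEq ι] [Fintype α]
    (f : (ι → α) → ℝ) (i : ι) :
    ∑ θ : ι → α, ∑ a, f (Function.update θ i a) = Fintype.card α * ∑ θ, f θ := by
  -- Exchange the fresh value with the stored one.
  have hinv : Function.Involutive fun p : (ι → α) × α => (Function.update p.1 i p.2, p.1 i) := by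
    rintro ⟨θ, a⟩
    simp
  have h1 : ∑ p : (ι → α) × α, f (Function.update p.1 i p.2) = ∑ p : (ι → α) × α, f p.1 :=
    Fintype.sum_equiv hinv.toPerm _ _ fun p => rfl
  rw [Fintype.sum_prod_type, Fintype.sum_prod_type] at h1
  rw [h1, Finset.mul_sum]
  simp

/-- The rates of a process in which, during the `j`-th block of `L` episodes, action `a` in state
`x` at step `h` is better by `ε` than the others if `η j h x = some a`. In the last step of the
episode the rate `u m` depends on the episode only. -/
noncomputable def hiddenRate {S A : Type} [DecidableEq A] (δ ε : ℝ) (u : ℕ → ℝ) (H L : ℕ)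
    (η : ℕ → ℕ → S → Option A) (m h : ℕ) (x : S) (a : A) : unitInterval :=
  Set.projIcc 0 1 zero_le_one
    (if h + 1 < H then δ + (if η (m / L) h x = some a then ε else 0) else u m)

theorem hiddenRate_coe {S A : Type} [DecidableEq A] {δ ε : ℝ} (hδ : 0 < δ) (hδ2 : δ ≤ 1 / 4)
    (hε : 0 ≤ ε) (hεδ : ε ≤ δ) (u : ℕ → ℝ) {H : ℕ} (L : ℕ) (η : ℕ → ℕ → S → Option A) (m : ℕ)
    {h : ℕ} (hh : h + 1 < H) (x : S) (a : A) :
    (hiddenRate δ ε u H L η m h x a : ℝ) = δ + if η (m / L) h x = some a then ε else 0 := by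
  rw [hiddenRate, if_pos hh, Set.projIcc_of_mem]
  constructor <;> split_ifs <;> linarith

theorem hiddenRate_coe_last {S A : Type} [DecidableEq A] (δ ε : ℝ) {u : ℕ → ℝ} {H h : ℕ} (L : ℕ)
    (η : ℕ → ℕ → S → Option A) {m : ℕ} (hu : u m ∈ Set.Icc (0 : ℝ) 1) (hh : ¬ h + 1 < H)
    (x : S) (a : A) : (hiddenRate δ ε u H L η m h x a : ℝ) = u m := by
  rw [hiddenRate, if_neg hh, Set.projIcc_of_mem _ hu]

/-- Prescribe the better action at one place. -/
def setArm {S A : Type} [DecidableEq S] (η : ℕ → ℕ → S → Option A) (j k : ℕ) (s : S)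
    (o : Option A) (j' k' : ℕ) (s' : S) : Option A :=
  if j' = j ∧ k' = k ∧ s' = s then o else η j' k' s'

/-- The better actions given by a table, in the even blocks only. -/
def tableArm {S A : Type} {M H : ℕ} (θ : Fin M × Fin H × S → A) (j h : ℕ) (x : S) : Option A :=
  if hj : (j < M ∧ h < H) ∧ j % 2 = 0 then some (θ (⟨j, hj.1.1⟩, ⟨h, hj.1.2⟩, x)) else none

/-- Erasing the place first gives a reference process that does not depend on the table's entry
there; filling it in amounts to resampling that coordinate. -/
theorem setArm_tableArm {S A : Type} [DecidableEq S] {M H : ℕ} (θ : Fin M × Fin H × S → A)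
    (j : Fin M) (k : Fin H) (s : S) (a : A) (hj : (j : ℕ) % 2 = 0) :
    setArm (setArm (tableArm θ) j k s none) j k s (some a) =
      tableArm (Function.update θ (j, k, s) a) := by
  funext j' k' s'
  simp only [setArm, tableArm]
  by_cases h : j' = (j : ℕ) ∧ k' = (k : ℕ) ∧ s' = s
  · obtain ⟨rfl, rfl, rfl⟩ := h
    simp [hj]
  · rw [if_neg h, if_neg h]
    split_ifs with h'
    · rw [Function.update_of_ne]
      intro h2
      simp only [Prod.mk.injEq, Fin.ext_iff] at h2
      exact h h2
    · rfl

namespace climbMDP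

open NonstationaryMDP

variable {S A : Type} [Fintype S] [DecidableEq S] [Fintype A]
  {g : S} {init : ℕ → S} {δ ε : ℝ} {u : ℕ → ℝ} {H L M : ℕ}

/-- The expected number of visits is at most the number of possible visits. -/
theorem sum_visitProb_le (ρ : ℕ → ℕ → S → A → unitInterval) (alg : LearningAlgorithm S A)
    {s : S} (hs : s ≠ g) (hH : 0 < H) (j k : ℕ) {n : ℕ} (hn : n ≤ M * H) :
    ∑ i ∈ (Finset.range n).filter (fun i => i / H / L = j ∧ i % H = k),
      (climbMDP g init ρ).visitProb H alg i s ≤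
      (((Finset.range M).filter fun m => m / L = j ∧ init m = s).card : ℝ) := by
  have h1 : ∀ i ∈ (Finset.range n).filter (fun i => i / H / L = j ∧ i % H = k),
      (climbMDP g init ρ).visitProb H alg i s ≤ if init (i / H) = s then 1 else 0 := by
    intro i _
    split_ifs with hi
    · exact visitProb_le_one _ _ _ _ _
    · have := visitProb_eq_zero g init ρ alg (m := i / H) (Nat.mod_lt i hH) hs (Ne.symm hi)
      rw [Nat.div_add_mod'] at this
      exact this.le
  refine (Finset.sum_le_sum h1).trans ?_
  rw [← Finset.sum_filter, Finset.sum_const, nsmul_eq_mul, mul_one]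
  norm_cast
  refine Finset.card_le_card_of_injOn (fun i => i / H) ?_ ?_
  · intro i hi
    simp only [Finset.coe_filter, Finset.mem_filter, Finset.mem_range, Set.mem_ofPred_eq] at hi ⊢
    exact ⟨Nat.div_lt_of_lt_mul (by rw [mul_comm]; omega), hi.1.2.1, hi.2⟩
  · intro i hi i' hi' h
    simp only [Finset.coe_filter, Finset.mem_filter, Set.mem_ofPred_eq] at hi hi' h
    rw [← Nat.div_add_mod' i H, ← Nat.div_add_mod' i' H, h, hi.1.2.2, hi'.1.2.2]

variable [DecidableEq A]

/-- On average over the choice of the better action, it is not played much more often than under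
a uniform choice. -/
theorem sum_playProb_setArm_le (hδ : 0 < δ) (hδ2 : δ ≤ 1 / 4) (hε : 0 ≤ ε) (hεδ : ε ≤ δ)
    (alg : LearningAlgorithm S A) {s : S} (hs : s ≠ g) (η : ℕ → ℕ → S → Option A) {j k : ℕ}
    (hk : k + 1 < H) {n : ℕ} (hn : n ≤ M * H) :
    ∑ a, (climbMDP g init (hiddenRate δ ε u H L (setArm (setArm η j k s none) j k s (some a)))
      ).playProb H alg n s a ≤ 1 + Fintype.card A / 16 + 32 * (ε ^ 2 / δ) *
      (((Finset.range M).filter fun m => m / L = j ∧ init m = s).card : ℝ) := by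
  set η₀ := setArm η j k s none with hη₀
  have h0 : η₀ j k s = none := by simp [hη₀, setArm]
  have h1 := fun a => playProb_le_reference g init (hiddenRate δ ε u H L η₀)
    (hiddenRate δ ε u H L (setArm η₀ j k s (some a))) (a₀ := a)
    (B := fun i => i / H / L = j ∧ i % H = k) hs hδ hδ2 hε hεδ alg
    (H := H) (by
      rintro i ⟨hi1, hi2⟩
      rw [hi2, hiddenRate_coe hδ hδ2 hε hεδ _ _ _ _ hk, hiddenRate_coe hδ hδ2 hε hεδ _ _ _ _ hk,
        hi1, h0]
      simp [setArm])
    (by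
      intro i x b hb
      simp only [hiddenRate, setArm]
      congr 3
      by_cases hx : i / H / L = j ∧ i % H = k ∧ x = s
      · obtain ⟨hx1, hx2, rfl⟩ := hx
        have hba : b ≠ a := fun h => hb ⟨⟨hx1, hx2⟩, rfl, h⟩
        simp [hx1, hx2, h0, hba.symm]
      · simp [hx]) n
  refine (Finset.sum_le_sum fun a _ => h1 a).trans ?_
  -- The reference does not depend on `a`, so its play probabilities add up to visit probabilities:
  -- this saves the factor `A`.
  rw [Finset.sum_add_distrib, Finset.sum_add_distrib, sum_playProb, ← Finset.mul_sum,
    Finset.sum_comm]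
  simp only [sum_playProb]
  have h2 := sum_visitProb_le (init := init) (M := M) (L := L) (hiddenRate δ ε u H L η₀) alg hs
    (by omega) j k hn
  have h3 := visitProb_le_one (climbMDP g init (hiddenRate δ ε u H L η₀)) H alg n s
  have h4 := mul_le_mul_of_nonneg_left h2 (show 0 ≤ 32 * (ε ^ 2 / δ) by positivity)
  simp only [Finset.sum_const, Finset.card_univ, nsmul_eq_mul]
  linarith

/-- In a block with a better action, the average shortfall is of order `ε`. -/
theorem le_sum_shortfall (hδ : 0 < δ) (hε : 0 ≤ ε) (hεδ : ε ≤ δ)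
    (hH : 2 ≤ H) (hδH : 8 * H * δ ≤ 1) (hA : 2 ≤ Fintype.card A)
    (alg : LearningAlgorithm S A) (hinit : ∀ m, init m ≠ g)
    (hcnt : ∀ j s, 32 * (ε ^ 2 / δ) *
      (((Finset.range M).filter fun m => m / L = j ∧ init m = s).card : ℝ) ≤ Fintype.card A / 16)
    {m k : ℕ} (hm : m < M) (hon : m / L % 2 = 0) (hk : k + 1 < H) :
    (Fintype.card (Fin M × Fin H × S → A) : ℝ) * (ε / 8) ≤
      ∑ θ : Fin M × Fin H × S → A, ∑ a,
        (climbMDP g init (hiddenRate δ ε u H L (tableArm θ))).playProb H alg (m * H + k) (init m) a *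
          ((δ + ε) - hiddenRate δ ε u H L (tableArm θ) m k (init m) a) := by
  have hH' : (2 : ℝ) ≤ H := by exact_mod_cast hH
  have hδ2 : δ ≤ 1 / 4 := by nlinarith
  have hjM : m / L < M := (Nat.div_le_self m L).trans_lt hm
  set i : Fin M × Fin H × S := (⟨m / L, hjM⟩, ⟨k, by omega⟩, init m) with hi
  have harm : ∀ θ : Fin M × Fin H × S → A, tableArm θ (m / L) k (init m) = some (θ i) := by
    intro θ
    rw [tableArm, dif_pos ⟨⟨hjM, by omega⟩, hon⟩]
  set p : (Fin M × Fin H × S → A) → ℝ := fun θ =>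
    (climbMDP g init (hiddenRate δ ε u H L (tableArm θ))).playProb H alg (m * H + k) (init m) (θ i)
    with hp
  have havg : (Fintype.card A : ℝ) * ∑ θ, p θ ≤
      Fintype.card (Fin M × Fin H × S → A) * (1 + Fintype.card A / 8) := by
    rw [← sum_sum_update p i, ← Finset.card_univ, ← nsmul_eq_mul, ← Finset.sum_const]
    refine Finset.sum_le_sum fun θ _ => ?_
    have h1 := sum_playProb_setArm_le (init := init) (u := u) (L := L) (M := M) hδ hδ2 hε hεδ alg
      (hinit m) (tableArm θ) (j := m / L) hk (n := m * H + k) (by nlinarith)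
    have h2 := hcnt (m / L) (init m)
    refine le_trans (le_of_eq (Finset.sum_congr rfl fun a _ => ?_)) (h1.trans (by linarith))
    simp only [hp, Function.update_self]
    rw [← setArm_tableArm θ ⟨m / L, hjM⟩ ⟨k, by omega⟩ (init m) a hon]
  -- Bernoulli, with `H * (δ + ε) ≤ 2 * H * δ ≤ 1/4`.
  have hpow : (3 / 4 : ℝ) ≤ (1 - (δ + ε)) ^ k := by
    have hb := one_add_mul_le_pow (a := -(δ + ε)) (by linarith) k
    have hkH : (k : ℝ) ≤ H := by exact_mod_cast (by omega : k ≤ H)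
    rw [← sub_eq_add_neg] at hb
    refine le_trans ?_ hb
    nlinarith
  have hterm : ∀ θ : Fin M × Fin H × S → A, ε * (3 / 4 - p θ) ≤ ∑ a,
        (climbMDP g init (hiddenRate δ ε u H L (tableArm θ))).playProb H alg (m * H + k) (init m) a *
          ((δ + ε) - hiddenRate δ ε u H L (tableArm θ) m k (init m) a) := by
    intro θ
    have hq := le_visitProb g init (hiddenRate δ ε u H L (tableArm θ)) (H := H) (m := m)
      (r := δ + ε) (by linarith) alg (hinit m) (by
        intro h x a hh _
        rw [hiddenRate_coe hδ hδ2 hε hεδ _ _ _ _ hh]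
        split_ifs <;> linarith) (h := k) (by omega)
    simp only [hiddenRate_coe hδ hδ2 hε hεδ _ _ _ _ hk, harm, Option.some.injEq]
    have : ∀ a, (climbMDP g init (hiddenRate δ ε u H L (tableArm θ))).playProb H alg (m * H + k)
        (init m) a * (δ + ε - (δ + if θ i = a then ε else 0)) =
        ε * (climbMDP g init (hiddenRate δ ε u H L (tableArm θ))).playProb H alg (m * H + k)
        (init m) a - if θ i = a then ε * (climbMDP g init (hiddenRate δ ε u H L (tableArm θ))
          ).playProb H alg (m * H + k) (init m) a else 0 := by
      intro a; split_ifs <;> ring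
    rw [Finset.sum_congr rfl fun a _ => this a, Finset.sum_sub_distrib, ← Finset.mul_sum,
      sum_playProb, Finset.sum_ite_eq, if_pos (Finset.mem_univ _)]
    have := mul_le_mul_of_nonneg_left (hpow.trans hq) hε
    simp only [hp]
    linarith
  refine le_trans ?_ (Finset.sum_le_sum fun θ _ => hterm θ)
  rw [← Finset.mul_sum, Finset.sum_sub_distrib, Finset.sum_const, Finset.card_univ, nsmul_eq_mul]
  have hA' : (2 : ℝ) ≤ Fintype.card A := by exact_mod_cast hA
  set N : ℝ := (Fintype.card (Fin M × Fin H × S → A) : ℝ) with hN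
  have hN0 : 0 ≤ N := Nat.cast_nonneg _
  -- `1/A + 1/8 ≤ 5/8` as `A ≥ 2`; the shortfall is then at least `ε * (3/4 - 5/8)`.
  have h58 : ∑ θ, p θ ≤ N * (5 / 8) := by
    have : (Fintype.card A : ℝ) * ∑ θ, p θ ≤ Fintype.card A * (N * (5 / 8)) := by nlinarith
    exact le_of_mul_le_mul_left this (by linarith)
  nlinarith

/-- At least half of the episodes belong to an even block. -/
theorem half_le_card_even_blocks (M L : ℕ) :
    (M / 2 : ℝ) ≤ ((Finset.range M).filter fun m => m / L % 2 = 0).card := by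
  have h1 : ((Finset.range M).filter fun m => ¬ m / L % 2 = 0).card ≤
      ((Finset.range M).filter fun m => m / L % 2 = 0).card := by
    have hL : ∀ m, ¬ m / L % 2 = 0 → 0 < L ∧ L ≤ m := by
      intro m hm
      rcases Nat.eq_zero_or_pos L with rfl | h
      · simp at hm
      · refine ⟨h, ?_⟩
        by_contra hlt
        rw [Nat.div_eq_of_lt (by omega)] at hm
        omega
    -- An episode of an odd block is matched with one of the even block just before it. For `L = 0`
    -- the quotient is `0`, hence even.
    refine Finset.card_le_card_of_injOn (fun m => m - L) ?_ ?_
    · intro m hm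
      simp only [Finset.coe_filter, Finset.mem_range, Set.mem_ofPred_eq] at hm ⊢
      obtain ⟨h1, h2⟩ := hL m hm.2
      refine ⟨by omega, ?_⟩
      have := Nat.sub_mul_div m L 1
      rw [mul_one] at this
      rw [this]
      omega
    · intro m hm m' hm' h
      simp only [Finset.coe_filter, Set.mem_ofPred_eq] at hm hm' h
      have := hL m hm.2
      have := hL m' hm'.2
      omega
  have h2 := Finset.card_filter_add_card_filter_not (s := Finset.range M)
    (fun m => m / L % 2 = 0)
  rw [Finset.card_range] at h2
  have : M ≤ 2 * ((Finset.range M).filter fun m => m / L % 2 = 0).card := by omega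
  have : (M : ℝ) ≤ 2 * ((Finset.range M).filter fun m => m / L % 2 = 0).card := by
    exact_mod_cast this
  linarith

theorem exists_le_dynamicRegret (hδ : 0 < δ) (hε : 0 ≤ ε) (hεδ : ε ≤ δ)
    (hH : 2 ≤ H) (hδH : 8 * H * δ ≤ 1) (hA : 2 ≤ Fintype.card A)
    (alg : LearningAlgorithm S A) (hinit : ∀ m, init m ≠ g)
    (hcnt : ∀ j s, 32 * (ε ^ 2 / δ) *
      (((Finset.range M).filter fun m => m / L = j ∧ init m = s).card : ℝ) ≤
        Fintype.card A / 16) :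
    ∃ θ : Fin M × Fin H × S → A, M / 2 * (ε * H ^ 2 / 64) ≤
      (climbMDP g init (hiddenRate δ ε u H L (tableArm θ))).dynamicRegret M H alg := by
  have hH' : (2 : ℝ) ≤ H := by exact_mod_cast hH
  have hδ2 : δ ≤ 1 / 4 := by nlinarith
  have hne : Nonempty A := Fintype.card_pos_iff.1 (by omega)
  set E := fun θ : Fin M × Fin H × S → A => climbMDP g init (hiddenRate δ ε u H L (tableArm θ))
    with hE
  set R := fun (θ : Fin M × Fin H × S → A) (m : ℕ) =>
    (E θ).optimalValue H m 0 (init m) - (E θ).algorithmValue H alg m with hR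
  have hpow : (3 / 4 : ℝ) ≤ (1 - (δ + ε)) ^ H := by
    have hb := one_add_mul_le_pow (a := -(δ + ε)) (by linarith) H
    rw [← sub_eq_add_neg] at hb
    refine le_trans ?_ hb
    nlinarith
  -- In an odd block all actions have rate `δ` before the last step, so the lower bound on the
  -- episode's regret is `0`.
  have hoff : ∀ θ m, ¬ m / L % 2 = 0 → 0 ≤ R θ m := by
    intro θ m hm
    have hrate : ∀ h x a, h + 1 < H →
        (hiddenRate δ ε u H L (tableArm θ) m h x a : ℝ) = δ := by
      intro h x a hh
      rw [hiddenRate_coe hδ hδ2 hε hεδ _ _ _ _ hh, tableArm, dif_neg (fun h => hm h.2)]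
      simp
    have := le_episodeRegret g init (hiddenRate δ ε u H L (tableArm θ)) (H := H) (m := m)
      hδ.le (by linarith) alg (hinit m) (fun _ _ => hne.some) (fun h x hh _ => hrate h x _ hh)
      (fun h x a hh _ => (hrate h x a hh).le)
    refine le_trans (le_of_eq ?_) this
    rw [Finset.sum_eq_zero, mul_zero, mul_zero]
    intro k hk
    have hk := Finset.mem_range.1 hk
    exact Finset.sum_eq_zero fun a _ => by rw [hrate _ _ _ (by omega), sub_self, mul_zero]
  have hon : ∀ m < M, m / L % 2 = 0 →
      (Fintype.card (Fin M × Fin H × S → A) : ℝ) * (ε * H ^ 2 / 64) ≤ ∑ θ, R θ m := by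
    intro m hm hon
    have hjM : m / L < M := (Nat.div_le_self m L).trans_lt hm
    have h1 : ∀ θ, _ ≤ R θ m := fun θ =>
      le_episodeRegret g init (hiddenRate δ ε u H L (tableArm θ)) (H := H) (m := m)
      (r := δ + ε) (by linarith) (by linarith) alg (hinit m)
      (fun h x => if hh : h < H then θ (⟨m / L, hjM⟩, ⟨h, hh⟩, x) else hne.some)
      (by
        intro h x hh _
        have hh' : h < H := by omega
        rw [hiddenRate_coe hδ hδ2 hε hεδ _ _ _ _ hh, tableArm, dif_pos ⟨⟨hjM, hh'⟩, hon⟩,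
          dif_pos hh', if_pos rfl])
      (by
        intro h x a hh _
        rw [hiddenRate_coe hδ hδ2 hε hεδ _ _ _ _ hh]
        split_ifs <;> linarith)
    refine le_trans ?_ (Finset.sum_le_sum fun θ _ => h1 θ)
    rw [← Finset.mul_sum, ← Finset.mul_sum, Finset.sum_comm]
    have h2 := Finset.sum_le_sum fun k (hk : k ∈ Finset.range (H / 2)) =>
      le_sum_shortfall (u := u) hδ hε hεδ hH hδH hA alg hinit hcnt hm hon
        (k := k) (by have := Finset.mem_range.1 hk; omega)
    rw [Finset.sum_const, Finset.card_range, nsmul_eq_mul] at h2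
    have h3 : (H / 3 : ℝ) ≤ ((H / 2 : ℕ) : ℝ) := by
      have : H ≤ 3 * (H / 2) := by omega
      have : (H : ℝ) ≤ 3 * ((H / 2 : ℕ) : ℝ) := by exact_mod_cast this
      linarith
    set N : ℝ := (Fintype.card (Fin M × Fin H × S → A) : ℝ) with hN
    have hN0 : 0 ≤ N * (ε / 8) := by positivity
    have h4 := (mul_le_mul_of_nonneg_right h3 hN0).trans h2
    -- The constant is `3/4 * (H/2) * (H/3) * (ε/8) = ε * H ^ 2 / 64`.
    have h5 := mul_le_mul hpow (mul_le_mul_of_nonneg_left h4 (show (0 : ℝ) ≤ H / 2 by positivity))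
      (by positivity) (by positivity)
    refine le_trans (le_of_eq ?_) h5
    ring
  have htot : (Fintype.card (Fin M × Fin H × S → A) : ℝ) * (M / 2 * (ε * H ^ 2 / 64)) ≤
      ∑ θ, (E θ).dynamicRegret M H alg := by
    have : ∀ θ, (E θ).dynamicRegret M H alg = ∑ m ∈ Finset.range M, R θ m := fun θ => rfl
    simp only [this]
    rw [Finset.sum_comm]
    have h1 : ∑ m ∈ (Finset.range M).filter (fun m => m / L % 2 = 0), ∑ θ, R θ m ≤
        ∑ m ∈ Finset.range M, ∑ θ, R θ m := by
      refine Finset.sum_le_sum_of_subset_of_nonneg (Finset.filter_subset _ _) fun m hm hm' => ?_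
      exact Finset.sum_nonneg fun θ _ => hoff θ m fun h => hm' (Finset.mem_filter.2 ⟨hm, h⟩)
    have h2 := Finset.sum_le_sum fun m
      (hm : m ∈ (Finset.range M).filter (fun m => m / L % 2 = 0)) =>
      hon m (Finset.mem_range.1 (Finset.mem_filter.1 hm).1) (Finset.mem_filter.1 hm).2
    rw [Finset.sum_const, nsmul_eq_mul] at h2
    have h3 := mul_le_mul_of_nonneg_right (half_le_card_even_blocks M L)
      (show 0 ≤ (Fintype.card (Fin M × Fin H × S → A) : ℝ) * (ε * H ^ 2 / 64) by positivity)
    linarith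
  have hneΘ : (Finset.univ : Finset (Fin M × Fin H × S → A)).Nonempty :=
    ⟨fun _ => hne.some, Finset.mem_univ _⟩
  obtain ⟨θ, _, hθ⟩ := Finset.exists_le_of_sum_le hneΘ
    (f := fun _ => (M / 2 * (ε * H ^ 2 / 64) : ℝ))
    (g := fun θ => (E θ).dynamicRegret M H alg)
    (by rw [Finset.sum_const, Finset.card_univ, nsmul_eq_mul]; exact htot)
  exact ⟨θ, hθ⟩

end climbMDP

/-! ### The exact variation of the instance. -/

theorem sum_abs_climbLaw_sub {S : Type} [Fintype S] [DecidableEq S] (g x : S)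
    (ρ ρ' : unitInterval) :
    ∑ y, |(climbLaw g x ρ y).toReal - (climbLaw g x ρ' y).toReal| =
      if x = g then 0 else 2 * |(ρ : ℝ) - ρ'| := by
  simp only [climbLaw_toReal]
  split_ifs with h
  · refine Finset.sum_eq_zero fun y _ => ?_
    by_cases hy : y = g <;> simp [h, hy]
  · rw [← Finset.sum_subset (Finset.subset_univ ({g, x} : Finset S)), Finset.sum_pair (Ne.symm h)]
    · simp only [h, Ne.symm h, if_true, if_false, add_zero, zero_add]
      rw [show (1 - (ρ : ℝ)) - (1 - ρ') = -((ρ : ℝ) - ρ') by ring, abs_neg]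
      ring
    · intro y _ hy
      simp only [Finset.mem_insert, Finset.mem_singleton, not_or] at hy
      simp [hy.1, hy.2]

theorem ciSup_eq_of_forall_le_of_exists {ι : Type*} {f : ι → ℝ} {c : ℝ} (h : ∀ i, f i ≤ c)
    (h' : ∃ i, f i = c) : ⨆ i, f i = c := by
  obtain ⟨i, hi⟩ := h'
  have : Nonempty ι := ⟨i⟩
  exact le_antisymm (ciSup_le h) (hi ▸ le_ciSup ⟨c, Set.forall_mem_range.2 h⟩ i)

theorem sum_block_boundaries (L n : ℕ) :
    ∑ m ∈ Finset.range n, (if (m + 1) / L = m / L then (0 : ℝ) else 1) = ((n / L : ℕ) : ℝ) := by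
  induction n with
  | zero => simp
  | succ n ih =>
    rw [Finset.sum_range_succ, ih, Nat.succ_div]
    split_ifs <;> simp_all

namespace climbMDP

variable {S A : Type} [Fintype S] [DecidableEq S]
  {g : S} {init : ℕ → S} {δ ε : ℝ} {u : ℕ → ℝ} {H L M : ℕ}

theorem rewardVariation_eq_zero (ρ : ℕ → ℕ → S → A → unitInterval) :
    (climbMDP g init ρ).rewardVariation M H = 0 := by
  simp [NonstationaryMDP.rewardVariation, meanReward_eq]

/-- The value does not depend on `θ`: of two neighbouring blocks exactly one is even, so at every
step before the last the kernels differ by exactly `2 * ε` at the hidden action. The last step adds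
`2 * v` between any two episodes. -/
theorem variation_eq [Fintype A] [DecidableEq A] (hδ : 0 < δ) (hδ2 : δ ≤ 1 / 4) (hε : 0 ≤ ε) (hεδ : ε ≤ δ) (hH : 0 < H)
    (hinit : ∀ m, init m ≠ g) [Nonempty A] {v : ℝ} (hu : ∀ m, u m ∈ Set.Icc (0 : ℝ) 1)
    (huv : ∀ m, |u m - u (m + 1)| = v) (θ : Fin M × Fin H × S → A) :
    (climbMDP g init (hiddenRate δ ε u H L (tableArm θ))).variation M H =
      ((M - 1) / L : ℕ) * ((H - 1 : ℕ) * (2 * ε)) + (M - 1 : ℕ) * (2 * v) := by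
  set ρ := hiddenRate δ ε u H L (tableArm θ) with hρ
  have hstep : ∀ m ∈ Finset.range (M - 1), ∀ h ∈ Finset.range H,
      (⨆ p : S × A, ∑ s' : S, |((climbMDP g init ρ).trans m h p.1 p.2 s').toReal -
        ((climbMDP g init ρ).trans (m + 1) h p.1 p.2 s').toReal|) =
      if h = H - 1 then 2 * v else if (m + 1) / L = m / L then 0 else 2 * ε := by
    intro m hm h hh
    have hm := Finset.mem_range.1 hm
    have hh := Finset.mem_range.1 hh
    have hsum : ∀ p : S × A, ∑ s' : S, |((climbMDP g init ρ).trans m h p.1 p.2 s').toReal -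
        ((climbMDP g init ρ).trans (m + 1) h p.1 p.2 s').toReal| =
        if p.1 = g then 0 else 2 * |(ρ m h p.1 p.2 : ℝ) - ρ (m + 1) h p.1 p.2| :=
      fun p => sum_abs_climbLaw_sub _ _ _ _
    simp only [hsum]
    obtain ⟨a₀⟩ := ‹Nonempty A›
    split_ifs with h1 h2
    · have hlast : ¬ h + 1 < H := by omega
      have hv : 0 ≤ v := huv 0 ▸ abs_nonneg _
      simp only [hρ, hiddenRate_coe_last _ _ _ _ (hu _) hlast, huv]
      refine ciSup_eq_of_forall_le_of_exists (fun p => ?_) ⟨(init m, a₀), if_neg (hinit m)⟩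
      split_ifs <;> linarith
    · simp only [hρ, hiddenRate_coe hδ hδ2 hε hεδ _ _ _ _ (show h + 1 < H by omega), h2]
      refine ciSup_eq_of_forall_le_of_exists (fun p => ?_) ⟨(init m, a₀), ?_⟩ <;> simp
    · simp only [hρ, hiddenRate_coe hδ hδ2 hε hεδ _ _ _ _ (show h + 1 < H by omega)]
      have h3 : (m + 1) / L = m / L + 1 := by
        rw [Nat.succ_div] at h2 ⊢
        split_ifs at h2 ⊢
        · rfl
        · simp at h2
      have hjM : m / L + 1 < M := by have := Nat.div_le_self m L; omega
      refine ciSup_eq_of_forall_le_of_exists (fun p => ?_) ?_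
      · split_ifs <;> simp [abs_of_nonneg hε] <;> linarith
      · rcases Nat.mod_two_eq_zero_or_one (m / L) with h4 | h4
        · refine ⟨(init m, θ (⟨m / L, by omega⟩, ⟨h, hh⟩, init m)), ?_⟩
          rw [if_neg (hinit m), tableArm, dif_pos ⟨⟨by omega, hh⟩, h4⟩, h3, tableArm,
            dif_neg (by omega)]
          simp [abs_of_nonneg hε]
        · refine ⟨(init m, θ (⟨m / L + 1, hjM⟩, ⟨h, hh⟩, init m)), ?_⟩
          rw [if_neg (hinit m), tableArm, dif_neg (by omega), h3, tableArm,
            dif_pos ⟨⟨hjM, hh⟩, by omega⟩]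
          simp [abs_of_nonneg hε]
  rw [NonstationaryMDP.variation, rewardVariation_eq_zero, zero_add,
    NonstationaryMDP.transitionVariation]
  rw [Finset.sum_congr rfl fun m hm => Finset.sum_congr rfl (hstep m hm)]
  obtain ⟨H', rfl⟩ : ∃ H', H = H' + 1 := ⟨H - 1, by omega⟩
  have hin : ∀ m, ∑ h ∈ Finset.range (H' + 1), (if h = H' + 1 - 1 then 2 * v else
      if (m + 1) / L = m / L then 0 else 2 * ε) =
      (if (m + 1) / L = m / L then (0 : ℝ) else 1) * (H' * (2 * ε)) + 2 * v := by
    intro m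
    rw [Nat.add_sub_cancel, Finset.sum_range_succ, if_pos rfl, Finset.sum_congr rfl fun h hh =>
      if_neg (Finset.mem_range.1 hh).ne, Finset.sum_const, Finset.card_range, nsmul_eq_mul]
    split_ifs <;> ring
  simp only [hin]
  rw [Finset.sum_add_distrib, ← Finset.sum_mul, sum_block_boundaries, Finset.sum_const,
    Finset.card_range, nsmul_eq_mul]
  simp

end climbMDP

/-! ### Counting visits and choosing the parameters. -/

theorem card_filter_div_mod_le {M L N : ℕ} (hL : 0 < L) (j t : ℕ) :
    ((Finset.range M).filter fun m => m / L = j ∧ m % N = t).card ≤ L / N + 1 := by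
  have hmem : ∀ m, m / L = j → L * j ≤ m ∧ m < L * j + L := fun m hm => by
    have := Nat.div_add_mod m L
    have := Nat.mod_lt m hL
    rw [hm] at *
    omega
  rw [← Finset.card_range (L / N + 1)]
  refine Finset.card_le_card_of_injOn (fun m => (m - L * j) / N) ?_ ?_
  · intro m hm
    simp only [Finset.coe_filter, Set.mem_ofPred_eq] at hm
    simp only [Finset.coe_range, Set.mem_Iio]
    have := hmem m hm.2.1
    have : (m - L * j) / N ≤ L / N := Nat.div_le_div_right (by omega)
    omega
  · intro m hm m' hm' h
    simp only [Finset.coe_filter, Set.mem_ofPred_eq] at hm hm' h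
    have h1 := hmem m hm.2.1
    have h2 := hmem m' hm'.2.1
    have h3 : (m - L * j) % N = (m' - L * j) % N := by
      have : m ≡ m' [MOD N] := hm.2.2.trans hm'.2.2.symm
      refine Nat.ModEq.add_right_cancel' (L * j) (show _ ≡ _ [MOD N] from ?_)
      rwa [Nat.sub_add_cancel h1.1, Nat.sub_add_cancel h2.1]
    have h4 : m - L * j = m' - L * j := by
      rw [← Nat.div_add_mod (m - L * j) N, ← Nat.div_add_mod (m' - L * j) N, h, h3]
    omega

theorem lowerBound_cube {S A Δ H T : ℝ} (hS : 0 ≤ S) (hA : 0 ≤ A) (hΔ : 0 ≤ Δ) (hH : 0 ≤ H)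
    (hT : 0 ≤ T) :
    (S ^ (1 / 3 : ℝ) * A ^ (1 / 3 : ℝ) * Δ ^ (1 / 3 : ℝ) * H ^ (2 / 3 : ℝ) * T ^ (2 / 3 : ℝ)) ^ 3 =
      S * A * Δ * H ^ 2 * T ^ 2 := by
  have h1 : ∀ x : ℝ, 0 ≤ x → (x ^ (1 / 3 : ℝ)) ^ 3 = x := fun x hx => by
    rw [← Real.rpow_natCast, ← Real.rpow_mul hx]; norm_num
  have h2 : ∀ x : ℝ, 0 ≤ x → (x ^ (2 / 3 : ℝ)) ^ 3 = x ^ 2 := fun x hx => by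
    rw [← Real.rpow_natCast, ← Real.rpow_mul hx, ← Real.rpow_natCast]; norm_num
  simp only [mul_pow]
  rw [h1 S hS, h1 A hA, h1 Δ hΔ, h2 H hH, h2 T hT]

/-- With gap `ε` and blocks of `L` episodes, the information gathered on one place within a block
does not suffice to find the better action. -/
theorem information_le {S A H M Δ ε L k : ℝ} (hS : 2 ≤ S) (hA : 2 ≤ A) (hH : 2 ≤ H)
    (hM : 2 ≤ M) (hΔ : 0 < Δ) (hε : 0 < ε) (hε3 : (64 * ε) ^ 3 * (M * H ^ 2) = S * A * Δ)
    (hεH : 64 * ε * H ≤ 1) (hL : L ≤ 2 * ε * H * M / Δ + 1) (hk : k ≤ 2 * L / S + 1) :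
    32 * (ε ^ 2 / (1 / (8 * H))) * k ≤ A / 16 := by
  have hc : 0 < 256 * H * ε ^ 2 := by positivity
  rw [show 32 * (ε ^ 2 / (1 / (8 * H))) = 256 * H * ε ^ 2 by field_simp; norm_num]
  have h0 : 256 * H * ε ^ 2 ≤ 1 / 32 := by nlinarith [mul_pos hε (by linarith : 0 < H)]
  -- The main part of `L` contributes `1024 / 64 ^ 3 * A = A / 256` by the cubic equation for `ε`;
  -- the rounding of `L` contributes at most `1/32`.
  have h1 : 256 * H * ε ^ 2 * (2 * L / S) ≤ A / 256 + 1 / 32 := by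
    have h2 : 256 * H * ε ^ 2 * (2 * (2 * ε * H * M / Δ + 1) / S) =
        A / 256 + 256 * H * ε ^ 2 * (2 / S) := by
      have h3 : 256 * H * ε ^ 2 * (2 * (2 * ε * H * M / Δ) / S) =
          (64 * ε) ^ 3 * (M * H ^ 2) / (256 * Δ * S) := by
        field_simp; norm_num
      rw [hε3] at h3
      have h4 : S * A * Δ / (256 * Δ * S) = A / 256 := by field_simp
      rw [← h4, ← h3]
      ring
    have h5 : 256 * H * ε ^ 2 * (2 / S) ≤ 256 * H * ε ^ 2 * 1 :=
      mul_le_mul_of_nonneg_left ((div_le_one (by linarith)).2 hS) hc.le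
    have h6 : 256 * H * ε ^ 2 * (2 * L / S) ≤
        256 * H * ε ^ 2 * (2 * (2 * ε * H * M / Δ + 1) / S) := by gcongr
    linarith
  have h7 := mul_le_mul_of_nonneg_left hk hc.le
  linarith

theorem mainTheorem4 :
    ∃ c C : ℝ, 0 < c ∧ 0 < C ∧
      ∀ (S A H M : ℕ) (Δ : ℝ), 2 ≤ S → 2 ≤ A → 2 ≤ H → 2 ≤ M → 0 < Δ →
        C * ((S : ℝ) * (A : ℝ) * Δ * (H : ℝ) ^ 2) ≤ ((M * H : ℕ) : ℝ) →
        ∀ alg : LearningAlgorithm (Fin S) (Fin A),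
          ∃ E : NonstationaryMDP (Fin S) (Fin A),
            -- the rewards do not vary over time
            (∀ m < M, ∀ m' < M, ∀ h < H, ∀ h' < H, E.rewardLaw m h = E.rewardLaw m' h') ∧
            E.variation M H = Δ ∧
            c * ((S : ℝ) ^ (1 / 3 : ℝ) * (A : ℝ) ^ (1 / 3 : ℝ) * Δ ^ (1 / 3 : ℝ) *
                (H : ℝ) ^ (2 / 3 : ℝ) * ((M * H : ℕ) : ℝ) ^ (2 / 3 : ℝ))
              ≤ E.dynamicRegret M H alg := by
  -- The regret bound `M / 2 * (ε * H ^ 2 / 64)` with `ε = X / (64 * M * H ^ 2)` is `X / 8192`.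
  refine ⟨1 / 8192, 1, by norm_num, one_pos, ?_⟩
  intro S A H M Δ hS hA hH hM hΔ hT alg
  have hS' : (2 : ℝ) ≤ S := by exact_mod_cast hS
  have hA' : (2 : ℝ) ≤ A := by exact_mod_cast hA
  have hH' : (2 : ℝ) ≤ H := by exact_mod_cast hH
  have hM' : (2 : ℝ) ≤ M := by exact_mod_cast hM
  have hX3 := lowerBound_cube (S := S) (A := A) (H := H) (T := ((M * H : ℕ) : ℝ)) (by positivity)
    (by positivity) hΔ.le (by positivity) (by positivity)
  set X : ℝ := (S : ℝ) ^ (1 / 3 : ℝ) * (A : ℝ) ^ (1 / 3 : ℝ) * Δ ^ (1 / 3 : ℝ) *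
    (H : ℝ) ^ (2 / 3 : ℝ) * ((M * H : ℕ) : ℝ) ^ (2 / 3 : ℝ) with hX
  have hX0 : 0 < X := by
    have : 0 < M * H := by positivity
    positivity
  push_cast at hX3 hT
  set ε : ℝ := X / (64 * (M * H ^ 2)) with hε
  have hε0 : 0 < ε := by positivity
  have hε3 : (64 * ε) ^ 3 * (M * H ^ 2) = S * A * Δ := by
    rw [show 64 * ε = X / (M * H ^ 2) by rw [hε]; field_simp, div_pow, hX3]
    field_simp
  have hSAΔ : (S : ℝ) * A * Δ * H ≤ M :=
    le_of_mul_le_mul_right (a := (H : ℝ)) (by linarith) (by linarith)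
  have hΔM : 8 * Δ ≤ M := by
    refine le_trans ?_ hSAΔ
    have h1 : (8 : ℝ) ≤ S * A * H := by
      have : (4 : ℝ) ≤ S * A := by nlinarith
      nlinarith
    linarith [mul_le_mul_of_nonneg_right h1 hΔ.le]
  -- This is where the lower bound on `T` enters: it keeps the gap below the base rate `1/(8H)`.
  have hεH : 64 * ε * H ≤ 1 := by
    refine le_of_pow_le_pow_left₀ (n := 3) (by norm_num) zero_le_one ?_
    refine le_of_mul_le_mul_right (a := (M : ℝ)) ?_ (by linarith)
    calc (64 * ε * H) ^ 3 * (M : ℝ) = (64 * ε) ^ 3 * (M * H ^ 2) * H := by ring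
      _ = S * A * Δ * H := by rw [hε3]
      _ ≤ 1 ^ 3 * M := by linarith
  -- The shortest blocks for which about `M / L` changes of cost `2 * ε * H` fit into `Δ`. If `L ≥
  -- M`, there is a single block, and it is even.
  set L : ℕ := ⌈2 * ε * H * M / Δ⌉₊ with hL
  have hLpos : 0 < L := Nat.ceil_pos.2 (by positivity)
  have hL1 : 2 * ε * H * M / Δ ≤ L := Nat.le_ceil _
  have hL2 : (L : ℝ) ≤ 2 * ε * H * M / Δ + 1 := (Nat.ceil_lt_add_one (by positivity)).le
  set δ : ℝ := 1 / (8 * H) with hδ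
  have hδ0 : 0 < δ := by positivity
  have hδH : 8 * H * δ ≤ 1 := by rw [hδ]; field_simp; rfl
  have hδ2 : δ ≤ 1 / 4 := by
    rw [hδ, div_le_div_iff₀ (by positivity) (by norm_num)]; linarith
  have hεδ : ε ≤ δ := by
    rw [hδ, le_div_iff₀ (by positivity)]
    linarith [mul_pos hε0 (by linarith : (0 : ℝ) < H)]
  set g : Fin S := ⟨S - 1, by omega⟩ with hg
  have hmod : ∀ m, m % (S - 1) < S - 1 := fun m => Nat.mod_lt _ (by omega)
  set init : ℕ → Fin S := fun m => ⟨m % (S - 1), by have := hmod m; omega⟩ with hinit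
  have hig : ∀ m, init m ≠ g := fun m h => by
    have := hmod m
    simp only [hinit, hg, Fin.mk.injEq] at h
    omega
  set used : ℝ := ((M - 1) / L : ℕ) * ((H - 1 : ℕ) * (2 * ε)) with hused
  have hused0 : 0 ≤ used := by positivity
  have hM1 : ((M - 1 : ℕ) : ℝ) = M - 1 := by rw [Nat.cast_sub (by omega), Nat.cast_one]
  have husedΔ : used ≤ Δ := by
    have h1 : (((M - 1) / L : ℕ) : ℝ) ≤ M / L :=
      Nat.cast_div_le.trans (by rw [hM1]; gcongr; linarith)
    have h2 : ((H - 1 : ℕ) : ℝ) ≤ H := by exact_mod_cast Nat.sub_le H 1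
    have h3 : used ≤ M / L * (H * (2 * ε)) := by rw [hused]; gcongr
    refine h3.trans ?_
    have hLr : (0 : ℝ) < L := by exact_mod_cast hLpos
    rw [div_le_iff₀ hΔ] at hL1
    rw [div_mul_eq_mul_div, div_le_iff₀ hLr]
    linarith
  -- The unused variation, spread evenly over the `M - 1` changes of episode; `8 * Δ ≤ M` makes `v`
  -- a legitimate rate.
  set v : ℝ := (Δ - used) / (2 * (M - 1)) with hv
  have hv0 : 0 ≤ v := div_nonneg (by linarith) (by linarith)
  have hv1 : v ≤ 1 := by rw [hv, div_le_one (by linarith)]; linarith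
  set u : ℕ → ℝ := fun m => if m % 2 = 0 then 0 else v with hu
  have hu01 : ∀ m, u m ∈ Set.Icc (0 : ℝ) 1 := fun m => by
    simp only [hu]; split_ifs <;> constructor <;> linarith
  have huv : ∀ m, |u m - u (m + 1)| = v := fun m => by
    rcases Nat.mod_two_eq_zero_or_one m with h | h
    · simp [hu, h, show (m + 1) % 2 = 1 by omega, abs_of_nonneg hv0]
    · simp [hu, h, show (m + 1) % 2 = 0 by omega, abs_of_nonneg hv0]
  have hS1 : ((S - 1 : ℕ) : ℝ) = S - 1 := by rw [Nat.cast_sub (by omega), Nat.cast_one]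
  obtain ⟨θ, hθ⟩ := climbMDP.exists_le_dynamicRegret (g := g) (init := init) (u := u) (M := M)
    (L := L) hδ0 hε0.le hεδ hH hδH (by simpa using hA) alg hig (by
      intro j s
      rw [Fintype.card_fin]
      refine information_le hS' hA' hH' hM' hΔ hε0 hε3 hεH hL2 ?_
      have h1 : ((Finset.range M).filter fun m => m / L = j ∧ init m = s).card ≤
          L / (S - 1) + 1 := by
        simp only [hinit, Fin.ext_iff]
        exact card_filter_div_mod_le hLpos j s
      have h2 : (((Finset.range M).filter fun m => m / L = j ∧ init m = s).card : ℝ) ≤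
          ((L / (S - 1) : ℕ) : ℝ) + 1 := by exact_mod_cast h1
      refine h2.trans (add_le_add_left (Nat.cast_div_le.trans ?_) _)
      -- `S - 1 ≥ S / 2` since `S ≥ 2`.
      rw [hS1, div_le_div_iff₀ (by linarith) (by linarith)]
      linarith [mul_le_mul_of_nonneg_left hS' (Nat.cast_nonneg (α := ℝ) L)])
  have : Nonempty (Fin A) := ⟨⟨0, by omega⟩⟩
  refine ⟨_, fun _ _ _ _ _ _ _ _ => rfl, ?_, le_trans (le_of_eq ?_) hθ⟩
  · rw [climbMDP.variation_eq hδ0 hδ2 hε0.le hεδ (by omega) hig hu01 huv, hM1, hv]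
    have : (M : ℝ) - 1 ≠ 0 := by linarith
    rw [← hused]
    field_simp
    ring
  · rw [hε]
    field_simp
    norm_num
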